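/- A \emph{path} in a finite simple graph is a sequence of pairwise distinct vertices in which consecutive vertices are adjacent. The \emph{disjoint paths problem} for a graph $G$ and terminal pairs $(s_0,t_0),\dots,(s_k,t_k)\in V(G)^2$ asks for pairwise vertex-disjoint paths $P_0,\dots,P_k$ in $G$ such that $P_i$ goes from $s_i$ to $t_i$; such a family $(P_0,\dots,P_k)$ is a \emph{solution}. A vertex $v$ of $G$ is \emph{irrelevant} if deleting it does not change the answer (solution exists / does not exist) to the problem; if $v$ is a terminal, the problem on $G-v$ counts as having no solution. The $n\times n$ \emph{grid} has vertex set $\{1,\dots,n\}^2$, and two vertices are adjacent if and only if they agree in one coordinate and differ by exactly $1$ in the other. \textbf{Corollary.} For every integer $k\ge 1$ there are a finite simple planar graph $G$ and $k+1$ pairs of terminals $(s_0,t_0),\dots,(s_k,t_k)$ in $G$ such that \begin{itemize} \item $G$ contains a $(2^k+1)\times(2^k+1)$ grid as a subgraph, \item the disjoint paths problem on this input has a unique solution, \item this solution uses all vertices of $G$; in particular, no vertex of $G$ is irrelevant. \end{itemize} -/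

import Mathlib

/-- The `m × n` grid: the vertices are the pairs `(i₁, i₂)`, and two vertices are adjacent when they
agree in one coordinate and differ by exactly one in the other. -/
def gridGraph (m n : ℕ) : SimpleGraph (Fin m × Fin n) where
  Adj p q :=
    (p.1 = q.1 ∧ |((q.2 : ℕ) : ℤ) - ((p.2 : ℕ) : ℤ)| = 1) ∨
      (|((q.1 : ℕ) : ℤ) - ((p.1 : ℕ) : ℤ)| = 1 ∧ p.2 = q.2)
  symm := ⟨by
    rintro p q (⟨h, h'⟩ | ⟨h, h'⟩)
    · exact Or.inl ⟨h.symm, by rwa [abs_sub_comm]⟩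
    · exact Or.inr ⟨by rwa [abs_sub_comm], h'.symm⟩⟩
  loopless := ⟨by
    rintro p (⟨-, h⟩ | ⟨h, -⟩) <;> simp at h⟩

/-- An embedding of a graph in the plane: the vertices are distinct points, every edge is a simple
arc joining its two ends, and the interior of an edge contains no vertex and no point of any
other edge. (Only the topology of the plane `ℝ × ℝ` matters.) -/
structure PlaneEmbedding {V : Type*} (G : SimpleGraph V) where
  point : V → ℝ × ℝ
  curve : G.edgeSet → unitInterval → ℝ × ℝ
  point_injective : Function.Injective point
  curve_continuous : ∀ e, Continuous (curve e)
  curve_injective : ∀ e, Function.Injective (curve e)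
  curve_ends : ∀ e, s(curve e 0, curve e 1) = Sym2.map point e.1
  interior_ne_point : ∀ e, ∀ x ∈ Set.Ioo (0 : unitInterval) 1, ∀ v, curve e x ≠ point v
  interior_notMem_curve : ∀ e, ∀ x ∈ Set.Ioo (0 : unitInterval) 1, ∀ e', e' ≠ e →
    curve e x ∉ Set.range (curve e')

/-- A graph is planar if it can be embedded in the plane. -/
def IsPlanarGraph {V : Type*} (G : SimpleGraph V) : Prop :=
  Nonempty (PlaneEmbedding G)

/-- A family of paths, the `i`-th one joining `s i` to `t i`, solves the disjoint paths problem if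
the paths are pairwise vertex disjoint. -/
def IsDisjointPathsSolution {V ι : Type*} {G : SimpleGraph V} {s t : ι → V}
    (P : ∀ i, G.Path (s i) (t i)) : Prop :=
  ∀ i j, i ≠ j → ∀ v, v ∈ (P i).1.support → v ∉ (P j).1.support

/-- The answer to the disjoint paths problem on `G` with terminal pairs `(s i, t i)` is yes. -/
def DisjointPathsSolvable {V ι : Type*} (G : SimpleGraph V) (s t : ι → V) : Prop :=
  ∃ P : ∀ i, G.Path (s i) (t i), IsDisjointPathsSolution P

/-- The answer to the disjoint paths problem with terminal pairs `(s i, t i)` is yes after deletion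
of the vertex `v`. This requires all terminals to be left, so that the answer is no
if `v` is a terminal. -/
def DisjointPathsSolvableDelete {V ι : Type*} (G : SimpleGraph V) (s t : ι → V) (v : V) : Prop :=
  ∃ (hs : ∀ i, s i ∈ ({v}ᶜ : Set V)) (ht : ∀ i, t i ∈ ({v}ᶜ : Set V)),
    DisjointPathsSolvable (G.induce ({v}ᶜ : Set V)) (fun i => ⟨s i, hs i⟩) (fun i => ⟨t i, ht i⟩)

/-- A vertex is irrelevant if its deletion does not affect the answer to the disjoint paths
problem. -/
def IsIrrelevantVertex {V ι : Type*} (G : SimpleGraph V) (s t : ι → V) (v : V) : Prop :=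
  DisjointPathsSolvable G s t ↔ DisjointPathsSolvableDelete G s t v

/-! The graph `foldGraph` is a grid whose rows are joined by nested arcs on both sides. The arcs
preserve the 2-adic valuation of the row number (`HasLevel.of_strandAdj`), and following the strand
of valuation `i` from the first terminal of pair `i` leads to the second one (`reachable_target`).
These strands give a solution.

For uniqueness, take any disjoint walks joining the pairs. Planar separation is replaced by parity:
`above` counts modulo 2 how often a walk crosses a column gap in the first rows. Off walk `i < k`
this number behaves like a side of a curve (`above_eq_of_adj`), except across the arcs around the
target of walk `i`. Those arcs are blocked by earlier walks (`arcs_taken`), so a later walk `a`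
stays on one side of walk `i`, namely side `1` if `a = i + 1` and side `0` otherwise
(`above_of_mem_support`).

Where the last of `n` walks crosses a gap, the walk before it has side `1`, while its side is `0` at
both ends of the range of rows. So that walk must cross both above and below, and recursively `n`
walks need `2 ^ n - 1` crossings (`card_crossings`). For all `k + 1` walks this is the number of
rows, so every horizontal edge is used (`horizontal_taken`); the same count in half a block of rows
yields `arcs_taken`. Hence all vertices are covered, a vertical edge would be a third path edge at
its end, and the paths must follow the strands. -/

open SimpleGraph

/-! ### Parity of edge counts, and paths in graphs of maximum degree two -/

/-- A walk meets every vertex in an even number of edge ends, except for its two ends. -/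
theorem walk_sum_count_edges {V : Type*} [DecidableEq V] {G : SimpleGraph V} {u v : V}
    (w : G.Walk u v) (x : V) (S : Finset V) (hS : ∀ y, G.Adj x y → y ∈ S) :
    ∑ y ∈ S, (w.edges.count s(x, y) : ZMod 2) =
      (if x = u then 1 else 0) + (if x = v then 1 else 0) := by
  induction w with
  | nil =>
    simp only [Walk.edges_nil, List.count_nil, Nat.cast_zero, Finset.sum_const_zero]
    split_ifs
    · exact (CharTwo.add_self_eq_zero (1 : ZMod 2)).symm
    · simp
  | @cons u u' v h w ih =>
    have key : ∑ y ∈ S, (if s(u, u') = s(x, y) then (1 : ZMod 2) else 0) =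
        (if x = u then 1 else 0) + (if x = u' then 1 else 0) := by
      by_cases hx : x = u
      · subst hx
        have hne : x ≠ u' := h.ne
        simp_rw [Sym2.congr_right]
        simp [hS _ h, hne]
      · by_cases hx' : x = u'
        · subst hx'
          have : ∀ y, (s(u, x) = s(x, y)) ↔ u = y := by
            intro y
            rw [Sym2.eq_swap (a := u), Sym2.congr_right]
          simp [this, hS _ h.symm, hx]
        · have : ∀ y, ¬ s(u, u') = s(x, y) := by
            intro y hy
            have : x ∈ s(u, u') := hy ▸ Sym2.mem_mk_left x y
            rw [Sym2.mem_iff] at this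
            tauto
          simp [this, hx, hx']
    have : ∀ y, (((Walk.cons h w).edges.count s(x, y) : ℕ) : ZMod 2) =
        (w.edges.count s(x, y) : ZMod 2) + if s(u, u') = s(x, y) then 1 else 0 := by
      intro y
      rw [Walk.edges_cons, List.count_cons]
      simp
    rw [Finset.sum_congr rfl fun y _ => this y, Finset.sum_add_distrib, ih, key]
    have h2 : (if x = u' then (1 : ZMod 2) else 0) + (if x = u' then 1 else 0) = 0 :=
      CharTwo.add_self_eq_zero _
    linear_combination h2

theorem mem_edges_of_count_ne_zero {V : Type*} [DecidableEq V] {l : List (Sym2 V)} {e : Sym2 V}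
    (h : (l.count e : ZMod 2) ≠ 0) : e ∈ l := by
  by_contra hn
  exact h (by rw [List.count_eq_zero_of_not_mem hn, Nat.cast_zero])

/-- The first edge of a path is its only edge at its first vertex. -/
theorem path_edge_at_start {V : Type*} {G : SimpleGraph V} {u x v y : V} {h : G.Adj u x}
    {w : G.Walk x v} (hw : (Walk.cons h w).IsPath) (hy : s(u, y) ∈ (Walk.cons h w).edges) :
    y = x := by
  rw [Walk.cons_isPath_iff] at hw
  rw [Walk.edges_cons, List.mem_cons] at hy
  rcases hy with hy | hy
  · exact Sym2.congr_right.1 hy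
  · exact absurd (w.fst_mem_support_of_mem_edges hy) hw.2

/-- No three edges of a path meet in a vertex. -/
theorem path_not_three_edges {V : Type*} {G : SimpleGraph V} {u v x a b c : V} (w : G.Walk u v)
    (hw : w.IsPath) (ha : s(x, a) ∈ w.edges) (hb : s(x, b) ∈ w.edges) (hc : s(x, c) ∈ w.edges) :
    a = b ∨ a = c ∨ b = c := by
  induction w with
  | nil => simp at ha
  | @cons u u' v h w ih =>
    by_cases hx : x = u
    · subst hx
      exact Or.inl ((path_edge_at_start hw ha).trans (path_edge_at_start hw hb).symm)
    · have hw' := hw.of_cons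
      by_cases hx' : x = u'
      · subst hx'
        have start : ∀ y z, s(x, y) ∈ w.edges → s(x, z) ∈ w.edges → y = z := by
          intro y z hy hz
          cases w with
          | nil => simp at hy
          | cons h' w' =>
            exact (path_edge_at_start hw' hy).trans (path_edge_at_start hw' hz).symm
        have alt : ∀ y, s(x, y) ∈ (Walk.cons h w).edges → y = u ∨ s(x, y) ∈ w.edges := by
          intro y hy
          rw [Walk.edges_cons, List.mem_cons] at hy
          refine hy.imp_left fun hy => ?_
          rw [Sym2.eq_swap (a := u)] at hy
          exact Sym2.congr_right.1 hy
        have := start a b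
        have := start a c
        have := start b c
        rcases alt a ha with ha | ha <;> rcases alt b hb with hb | hb <;>
          rcases alt c hc with hc | hc <;> simp_all
      · have alt : ∀ y, s(x, y) ∈ (Walk.cons h w).edges → s(x, y) ∈ w.edges := by
          intro y hy
          rw [Walk.edges_cons, List.mem_cons] at hy
          refine hy.resolve_left fun hy => ?_
          have : x ∈ s(u, u') := hy ▸ Sym2.mem_mk_left x y
          rw [Sym2.mem_iff] at this
          tauto
        exact ih hw' (alt a ha) (alt b hb) (alt c hc)

/-- In a graph of maximum degree two, a path is determined by its ends and by a neighbour of its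
first vertex that it avoids. -/
theorem path_unique_of_degree_le_two {V : Type*} {G : SimpleGraph V} {H : V → V → Prop}
    (hH : ∀ x y, H x y → H y x)
    (h3 : ∀ x a b c, H x a → H x b → H x c → a = b ∨ a = c ∨ b = c)
    {u v z : V} (p q : G.Walk u v) (hp : p.IsPath) (hq : q.IsPath)
    (hpH : ∀ x y, s(x, y) ∈ p.edges → H x y) (hqH : ∀ x y, s(x, y) ∈ q.edges → H x y)
    (hz : H u z) (hzp : z ∉ p.support) (hzq : z ∉ q.support) : p = q := by
  induction p generalizing z with
  | nil => exact (Walk.eq_nil_iff_nil.2 (Walk.isPath_iff_nil.1 hq)).symm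
  | @cons u x v h p ih =>
    have hp' := (Walk.cons_isPath_iff h p).1 hp
    cases q with
    | nil => exact absurd p.end_mem_support hp'.2
    | @cons _ y _ h' q =>
      have hq' := (Walk.cons_isPath_iff h' q).1 hq
      have hx : H u x := hpH u x (by simp)
      have hy : H u y := hqH u y (by simp)
      have hzx : z ≠ x := by rintro rfl; simp at hzp
      have hzy : z ≠ y := by rintro rfl; simp at hzq
      have hxy : x = y := by
        rcases h3 u x y z hx hy hz with e | e | e
        · exact e
        · exact absurd e.symm hzx
        · exact absurd e.symm hzy
      subst hxy
      rw [ih q hp'.1 hq'.1 (fun a b hab => hpH a b (by simp [hab]))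
        (fun a b hab => hqH a b (by simp [hab])) (hH _ _ hx) hp'.2 hq'.2]

/-- The first step is forced; from then on the vertex just left plays the role of the avoided
neighbour in `path_unique_of_degree_le_two`. -/
theorem path_unique_of_start_degree_one {V : Type*} {G : SimpleGraph V} {H : V → V → Prop}
    (hH : ∀ x y, H x y → H y x)
    (h3 : ∀ x a b c, H x a → H x b → H x c → a = b ∨ a = c ∨ b = c)
    {u v : V} (h1 : ∀ a b, H u a → H u b → a = b) (p q : G.Walk u v) (hp : p.IsPath)
    (hq : q.IsPath) (hpH : ∀ x y, s(x, y) ∈ p.edges → H x y)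
    (hqH : ∀ x y, s(x, y) ∈ q.edges → H x y) : p = q := by
  cases p with
  | nil => exact (Walk.eq_nil_iff_nil.2 (Walk.isPath_iff_nil.1 hq)).symm
  | @cons _ x _ h p =>
    have hp' := (Walk.cons_isPath_iff h p).1 hp
    cases q with
    | nil => exact absurd p.end_mem_support hp'.2
    | @cons _ y _ h' q =>
      have hq' := (Walk.cons_isPath_iff h' q).1 hq
      have hx : H u x := hpH u x (by simp)
      obtain rfl : x = y := h1 x y hx (hqH u y (by simp))
      rw [path_unique_of_degree_le_two hH h3 p q hp'.1 hq'.1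
        (fun a b hab => hpH a b (by simp [hab])) (fun a b hab => hqH a b (by simp [hab]))
        (hH _ _ hx) hp'.2 hq'.2]

/-- A solution of the disjoint paths problem after deletion of a vertex is a solution before that
avoids the vertex. -/
theorem not_isIrrelevantVertex_of_forall_mem {V ι : Type*} {G : SimpleGraph V} {s t : ι → V}
    (hsol : DisjointPathsSolvable G s t) {v : V}
    (hv : ∀ P : ∀ i, G.Path (s i) (t i), IsDisjointPathsSolution P → ∃ i, v ∈ (P i).1.support) :
    ¬ IsIrrelevantVertex G s t v := by
  intro h
  obtain ⟨hs, ht, Q, hQ⟩ := h.1 hsol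
  let f : G.induce ({v}ᶜ : Set V) ↪g G := SimpleGraph.Embedding.induce _
  let P : ∀ i, G.Path (s i) (t i) := fun i =>
    ⟨(Q i).1.map f.toHom, (Q i).2.map f.injective⟩
  have hP : ∀ i x, x ∈ (P i).1.support → ∃ y ∈ (Q i).1.support, (y : V) = x := by
    intro i x hx
    have hx : x ∈ ((Q i).1.map f.toHom).support := hx
    rw [Walk.support_map, List.mem_map] at hx
    exact hx
  obtain ⟨i, hi⟩ := hv P (by
    intro i j hij x hx hx'
    obtain ⟨y, hy, rfl⟩ := hP i x hx
    obtain ⟨y', hy', h'⟩ := hP j y hx'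
    exact hQ i j hij y hy (Subtype.ext h' ▸ hy'))
  obtain ⟨y, -, hy⟩ := hP i v hi
  exact y.2 hy

/-! ### The folded grid and its terminals -/

/-- The box of vertices: rows `1, …, 2 ^ (k + 1) - 1` and columns `0, …, L + 1`. -/
def InBox (k L : ℕ) (p : ℕ × ℕ) : Prop :=
  1 ≤ p.1 ∧ p.1 < 2 ^ (k + 1) ∧ p.2 ≤ L + 1

/-- Two rows are mirror images in the block of rows strictly between `2 ^ (m + 1)`
and `2 ^ (m + 2)`. -/
def Mirror (m r r' : ℕ) : Prop :=
  2 ^ (m + 1) < r ∧ 2 ^ (m + 1) < r' ∧ r + r' = 3 * 2 ^ (m + 1)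

/-- Adjacency along the strands: horizontal steps, the arcs on the left, and the arcs on the
right. -/
def StrandAdj (k L : ℕ) (p q : ℕ × ℕ) : Prop :=
  (p.1 = q.1 ∧ (p.2 + 1 = q.2 ∨ q.2 + 1 = p.2)) ∨
  (p.2 = 0 ∧ q.2 = 0 ∧ p.1 ≠ q.1 ∧ ∃ m, Mirror m p.1 q.1) ∨
  (p.2 = L + 1 ∧ q.2 = L + 1 ∧ p.1 ≠ q.1 ∧ p.1 + q.1 = 2 ^ (k + 1))

/-- Vertical steps in the columns `1, …, L`. -/
def VerticalAdj (L : ℕ) (p q : ℕ × ℕ) : Prop :=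
  p.2 = q.2 ∧ 1 ≤ p.2 ∧ p.2 ≤ L ∧ (p.1 + 1 = q.1 ∨ q.1 + 1 = p.1)

theorem Mirror.symm {m r r' : ℕ} (h : Mirror m r r') : Mirror m r' r :=
  ⟨h.2.1, h.1, by rw [add_comm]; exact h.2.2⟩

theorem Mirror.lt {m r r' : ℕ} (h : Mirror m r r') : r < 2 ^ (m + 2) := by
  obtain ⟨h1, h2, h3⟩ := h
  rw [pow_succ _ (m + 1)]
  omega

theorem StrandAdj.symm {k L : ℕ} {p q : ℕ × ℕ} (h : StrandAdj k L p q) : StrandAdj k L q p := by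
  rcases h with ⟨h, h'⟩ | ⟨h1, h2, h3, m, h4⟩ | ⟨h1, h2, h3, h4⟩
  · exact Or.inl ⟨h.symm, h'.symm⟩
  · exact Or.inr (Or.inl ⟨h2, h1, h3.symm, m, h4.symm⟩)
  · exact Or.inr (Or.inr ⟨h2, h1, h3.symm, by rw [add_comm]; exact h4⟩)

theorem VerticalAdj.symm {L : ℕ} {p q : ℕ × ℕ} (h : VerticalAdj L p q) : VerticalAdj L q p :=
  ⟨h.1.symm, h.1 ▸ h.2.1, h.1 ▸ h.2.2.1, h.2.2.2.symm⟩

/-- The grid with its rows joined at both sides by nested arcs, so that they form `k + 1`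
strands. -/
def foldGraph (k L : ℕ) : SimpleGraph (ℕ × ℕ) where
  Adj p q := InBox k L p ∧ InBox k L q ∧ (StrandAdj k L p q ∨ VerticalAdj L p q)
  symm := ⟨fun _ _ h => ⟨h.2.1, h.1, h.2.2.imp StrandAdj.symm VerticalAdj.symm⟩⟩
  loopless := ⟨by
    rintro p ⟨-, -, (⟨-, h⟩ | ⟨-, -, h, -⟩ | ⟨-, -, h, -⟩) | ⟨-, -, -, h⟩⟩
    · omega
    · exact h rfl
    · exact h rfl
    · omega⟩

/-- The second terminal of the `i`-th pair; the first one is `(2 ^ i, 0)`. -/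
def target (k L i : ℕ) : ℕ × ℕ :=
  if i = k then (2 ^ k, L + 1) else (3 * 2 ^ i, 0)

/-- The blocks between consecutive powers of two are disjoint, so a row lies in at most one of them.
-/
theorem mirror_index_unique {m n r a b : ℕ} (h : Mirror m r a) (h' : Mirror n r b) : m = n := by
  have h1 : 2 ^ (m + 1) < 2 ^ (n + 2) := h.1.trans h'.lt
  have h2 : 2 ^ (n + 1) < 2 ^ (m + 2) := h'.1.trans h.lt
  rw [Nat.pow_lt_pow_iff_right (by norm_num)] at h1 h2
  omega

theorem mirror_unique {m n r a b : ℕ} (h : Mirror m r a) (h' : Mirror n r b) : a = b := by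
  obtain rfl := mirror_index_unique h h'
  have h1 := h.2.2
  have h2 := h'.2.2
  omega

/-- A row without an arc on the left. -/
def IsHub (r : ℕ) : Prop := ∀ m r', Mirror m r r' → r = r'

theorem isHub_pow (i : ℕ) : IsHub (2 ^ i) := by
  intro m r' h
  have h1 := h.1
  have h2 := h.lt
  rw [Nat.pow_lt_pow_iff_right (by norm_num)] at h1 h2
  omega

theorem mirror_center (m d : ℕ) (hd : d < 2 ^ m) : Mirror m (3 * 2 ^ m - d) (3 * 2 ^ m + d) := by
  unfold Mirror
  rw [pow_succ]
  omega

theorem isHub_center (i : ℕ) : IsHub (3 * 2 ^ i) := by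
  intro m r' h
  exact mirror_unique (by simpa using mirror_center i 0 (by positivity)) h

/-! ### Crossing parities of an arbitrary walk -/

section Counts

variable {k L : ℕ} {u v : ℕ × ℕ} (w : (foldGraph k L).Walk u v)

/-- How often (modulo 2) a walk uses the edge from `(r, c)` to `(r, c + 1)`. -/
def hcount (c r : ℕ) : ZMod 2 := (w.edges.count s((r, c), (r, c + 1)) : ZMod 2)

/-- How often (modulo 2) a walk uses the edge from `(r, c)` to `(r + 1, c)`. -/
def vcount (c r : ℕ) : ZMod 2 := (w.edges.count s((r, c), (r + 1, c)) : ZMod 2)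

/-- The number of horizontal edges used between columns `c` and `c + 1` in the first `r` rows. -/
def above (c r : ℕ) : ZMod 2 := ∑ j ∈ Finset.range r, hcount w c (j + 1)

theorem above_zero (c : ℕ) : above w c 0 = 0 := Finset.sum_range_zero _

theorem above_succ (c r : ℕ) : above w c (r + 1) = above w c r + hcount w c (r + 1) :=
  Finset.sum_range_succ _ _

theorem mem_support_of_hcount_ne_zero {c r : ℕ} (h : hcount w c r ≠ 0) :
    (r, c) ∈ w.support ∧ (r, c + 1) ∈ w.support := by
  have := mem_edges_of_count_ne_zero h
  exact ⟨w.fst_mem_support_of_mem_edges this, w.snd_mem_support_of_mem_edges this⟩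

theorem hcount_eq_zero_left {c r : ℕ} (h : (r, c) ∉ w.support) : hcount w c r = 0 := by
  by_contra hn
  exact h (mem_support_of_hcount_ne_zero w hn).1

theorem hcount_eq_zero_right {c r : ℕ} (h : (r, c + 1) ∉ w.support) : hcount w c r = 0 := by
  by_contra hn
  exact h (mem_support_of_hcount_ne_zero w hn).2

theorem vcount_eq_zero_top {c r : ℕ} (h : (r, c) ∉ w.support) : vcount w c r = 0 := by
  by_contra hn
  exact h (w.fst_mem_support_of_mem_edges (mem_edges_of_count_ne_zero hn))

theorem vcount_eq_zero_of_not_inBox {c r : ℕ} (h : ¬ InBox k L (r, c) ∨ ¬ InBox k L (r + 1, c)) :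
    vcount w c r = 0 := by
  by_contra hn
  have : (foldGraph k L).Adj (r, c) (r + 1, c) :=
    w.adj_of_mem_edges (mem_edges_of_count_ne_zero hn)
  exact h.elim (fun h => h this.1) (fun h => h this.2.1)

theorem sum_counts_interior {c r : ℕ} (hc : c + 1 ≤ L) (hu : (r + 1, c + 1) ≠ u)
    (hv : (r + 1, c + 1) ≠ v) :
    hcount w c (r + 1) + hcount w (c + 1) (r + 1) + vcount w (c + 1) r + vcount w (c + 1) (r + 1)
      = 0 := by
  have := walk_sum_count_edges w (r + 1, c + 1)
    {(r + 1, c), (r + 1, c + 2), (r, c + 1), (r + 2, c + 1)} (by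
      rintro ⟨a, b⟩ ⟨-, -, (⟨h, h'⟩ | ⟨h, -⟩ | ⟨h, -⟩) | ⟨h1, -, -, h2⟩⟩ <;>
        simp at * <;> omega)
  rw [if_neg hu, if_neg hv, Finset.sum_insert (by simp), Finset.sum_insert (by simp),
    Finset.sum_insert (by simp), Finset.sum_singleton] at this
  unfold hcount vcount
  rw [Sym2.eq_swap (a := (r + 1, c)), Sym2.eq_swap (a := (r, c + 1))]
  linear_combination this

/-- Sum the degree parities of the first `r` vertices of column `c + 1`: the vertical edges among
them cancel in pairs, and only the one leaving downwards remains. The ends of the walk lie in the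
outer columns and do not contribute. -/
theorem above_add_above {c : ℕ} (r : ℕ) (hc : c + 1 ≤ L) (hu : u.2 = 0 ∨ u.2 = L + 1)
    (hv : v.2 = 0 ∨ v.2 = L + 1) :
    above w c r + above w (c + 1) r = vcount w (c + 1) r := by
  induction r with
  | zero =>
    rw [vcount_eq_zero_of_not_inBox w (Or.inl (by simp [InBox])), above_zero, above_zero, add_zero]
  | succ r ih =>
    have h := sum_counts_interior (r := r) w hc (by rintro rfl; simp at hu; omega)
      (by rintro rfl; simp at hv; omega)
    rw [above_succ, above_succ]
    have h3 := CharTwo.add_self_eq_zero (vcount w (c + 1) (r + 1))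
    linear_combination ih + h - h3

/-- Without an arc, the vertex `(r, 0)` has only its horizontal edge. -/
theorem hcount_hub {r : ℕ} (hr : IsHub r) :
    hcount w 0 r = (if (r, 0) = u then 1 else 0) + (if (r, 0) = v then 1 else 0) := by
  have := walk_sum_count_edges w (r, 0) {(r, 1)} (by
      rintro ⟨a, b⟩ ⟨-, -, (⟨h, h'⟩ | ⟨h, -, h', m, hm⟩ | ⟨h, -⟩) | ⟨-, h2, -⟩⟩
      · simp at *; omega
      · exact absurd (hr m a hm) h'
      · simp at h
      · simp at h2)
  rwa [Finset.sum_singleton] at this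

/-- Away from the ends of the walk, both parities equal that of the arc joining the two rows. -/
theorem hcount_mirror {m r r' : ℕ} (h : Mirror m r r') (hu : (r, 0) ≠ u) (hv : (r, 0) ≠ v)
    (hu' : (r', 0) ≠ u) (hv' : (r', 0) ≠ v) : hcount w 0 r = hcount w 0 r' := by
  have key : ∀ {a b}, Mirror m a b → (a, 0) ≠ u → (a, 0) ≠ v →
      hcount w 0 a = (w.edges.count s((a, 0), (b, 0)) : ZMod 2) := by
    intro a b hab hu hv
    have := walk_sum_count_edges w (a, 0) {(a, 1), (b, 0)} (by
      rintro ⟨c, d⟩ ⟨-, -, (⟨h, h'⟩ | ⟨h, h'', h', n, hn⟩ | ⟨h, -⟩) | ⟨-, h2, -⟩⟩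
      · simp at *; omega
      · have := mirror_unique hab hn
        simp at *; omega
      · simp at h
      · simp at h2)
    rw [if_neg hu, if_neg hv, Finset.sum_insert (by simp), Finset.sum_singleton, add_zero] at this
    exact CharTwo.add_eq_zero.1 this
  rw [key h hu hv, key h.symm hu' hv', Sym2.eq_swap]

theorem hcount_last_symm {r r' : ℕ} (h : r + r' = 2 ^ (k + 1)) (hu : (r, L + 1) ≠ u)
    (hv : (r, L + 1) ≠ v) (hu' : (r', L + 1) ≠ u) (hv' : (r', L + 1) ≠ v) :
    hcount w L r = hcount w L r' := by
  have key : ∀ {a b}, a + b = 2 ^ (k + 1) → (a, L + 1) ≠ u → (a, L + 1) ≠ v →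
      hcount w L a = (w.edges.count s((a, L + 1), (b, L + 1)) : ZMod 2) := by
    intro a b hab hu hv
    have := walk_sum_count_edges w (a, L + 1) {(a, L), (b, L + 1)} (by
      rintro ⟨c, d⟩ ⟨h0, h0', (⟨h, h'⟩ | ⟨h, -⟩ | ⟨h, h', h2, h3⟩) | ⟨-, -, h2, -⟩⟩
      · simp [InBox] at *; omega
      · simp at h
      · simp at *; omega
      · simp at h2)
    rw [if_neg hu, if_neg hv, Finset.sum_insert (by simp), Finset.sum_singleton, add_zero] at this
    unfold hcount
    rw [Sym2.eq_swap]
    exact CharTwo.add_eq_zero.1 this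
  rw [key h hu hv, key ((add_comm _ _).trans h) hu' hv', Sym2.eq_swap]

/-- Rows in symmetric position about `n` cancel modulo 2, which leaves only the middle row. -/
theorem above_symmetric {c n : ℕ} (d : ℕ) (hd : d < n)
    (h : ∀ j, 1 ≤ j → j ≤ d → hcount w c (n - j) = hcount w c (n + j)) :
    above w c (n + d) = above w c (n - d - 1) + hcount w c n := by
  induction d with
  | zero =>
    obtain ⟨n, rfl⟩ := Nat.exists_eq_add_of_lt hd
    simpa using above_succ w c n
  | succ d ih =>
    have h1 := ih (by omega) fun j hj hj' => h j hj (by omega)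
    have h2 := h (d + 1) (by omega) le_rfl
    have h3 := above_succ w c (n - (d + 1) - 1)
    rw [show n - (d + 1) - 1 + 1 = n - d - 1 by omega,
      show n - d - 1 = n - (d + 1) by omega] at h3
    rw [show n - d - 1 = n - (d + 1) by omega] at h1
    rw [← add_assoc, above_succ, h1, add_assoc n, ← h2, h3]
    have := CharTwo.add_self_eq_zero (hcount w c (n - (d + 1)))
    linear_combination this

end Counts

/-! ### Crossing parities of a walk joining the `i`-th pair -/

section Strands

variable {k L i : ℕ} (w : (foldGraph k L).Walk (2 ^ i, 0) (target k L i))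

theorem target_column (k L i : ℕ) : (target k L i).2 = 0 ∨ (target k L i).2 = L + 1 := by
  unfold target
  split_ifs <;> simp

theorem hcount_pow {a : ℕ} : hcount w 0 (2 ^ a) = if a = i then 1 else 0 := by
  rw [hcount_hub w (isHub_pow a)]
  have : (2 ^ a, 0) ≠ target k L i := by
    unfold target
    split_ifs
    · simp
    · intro h
      have h := congrArg Prod.fst h
      simp only at h
      have h3 : 3 ∣ 2 ^ a := ⟨_, h⟩
      have := (Nat.prime_three.dvd_of_dvd_pow h3)
      omega
  simp [this]

theorem pow_ne_three_mul_pow (a b : ℕ) : 2 ^ a ≠ 3 * 2 ^ b := by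
  intro h
  have h3 : 3 ∣ 2 ^ a := ⟨_, h⟩
  have := Nat.prime_three.dvd_of_dvd_pow h3
  omega

theorem hcount_center {a : ℕ} (ha : a < k) :
    hcount w 0 (3 * 2 ^ a) = if a = i then 1 else 0 := by
  rw [hcount_hub w (isHub_center a)]
  have : (3 * 2 ^ a, 0) ≠ (2 ^ i, 0) := by simpa using (pow_ne_three_mul_pow i a).symm
  rw [if_neg this, zero_add]
  congr 1
  unfold target
  by_cases h : i = k
  · simp [h]; omega
  · simp [h]

theorem hub_of_eq_start_or_target {r : ℕ} (h : (r, 0) = (2 ^ i, 0) ∨ (r, 0) = target k L i) :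
    IsHub r := by
  rcases h with h | h
  · rw [show r = 2 ^ i from congrArg Prod.fst h]
    exact isHub_pow i
  · unfold target at h
    split_ifs at h
    · simp at h
    · rw [show r = 3 * 2 ^ i from congrArg Prod.fst h]
      exact isHub_center i

/-- Terminals in column `0` lie in hub rows, so they never spoil a mirror pair of distinct rows. -/
theorem hcount_strand_mirror {m r r' : ℕ} (h : Mirror m r r') : hcount w 0 r = hcount w 0 r' := by
  by_cases hr : r = r'
  · rw [hr]
  have h1 : ¬ ((r, 0) = (2 ^ i, 0) ∨ (r, 0) = target k L i) := fun h' =>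
    hr (hub_of_eq_start_or_target h' m r' h)
  have h2 : ¬ ((r', 0) = (2 ^ i, 0) ∨ (r', 0) = target k L i) := fun h' =>
    hr (hub_of_eq_start_or_target h' m r h.symm).symm
  push Not at h1 h2
  exact hcount_mirror w h h1.1 h1.2 h2.1 h2.2

theorem above_block (m d : ℕ) (hd : d < 2 ^ m) :
    above w 0 (3 * 2 ^ m + d) = above w 0 (3 * 2 ^ m - d - 1) + hcount w 0 (3 * 2 ^ m) :=
  above_symmetric w d (by omega) fun j _ _ =>
    hcount_strand_mirror w (mirror_center m j (by omega))

/-- A whole block cancels up to its central row `3 * 2 ^ m`, a hub that holds the target of strand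
`m` only. -/
theorem above_full_block {m : ℕ} (hm : m < k) :
    above w 0 (2 ^ (m + 2) - 1) = above w 0 (2 ^ (m + 1)) + if m = i then 1 else 0 := by
  have h0 : 0 < 2 ^ m := by positivity
  have h := above_block w m (2 ^ m - 1) (by omega)
  rw [hcount_center w hm] at h
  convert h using 3
  · rw [pow_add]; omega
  · rw [pow_succ]; omega

/-- This is the side of strand `i` at the start of strand `a`. For `a > i` it is `1` exactly when `a
= i + 1`: the two summands come from the start of strand `i` and from its target. -/
theorem above_pow {a : ℕ} (ha : a ≤ k) :
    above w 0 (2 ^ a) = (if i ≤ a then 1 else 0) + if i + 2 ≤ a then 1 else 0 := by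
  induction a with
  | zero =>
    have h : above w 0 1 = above w 0 0 + hcount w 0 1 := above_succ w 0 0
    have h' := hcount_pow w (a := 0)
    rw [pow_zero] at h'
    rw [pow_zero, h, above_zero, h']
    simp [eq_comm]
  | succ a ih =>
    have h1 := above_succ w 0 (2 ^ (a + 1) - 1)
    rw [Nat.sub_add_cancel Nat.one_le_two_pow, hcount_pow w] at h1
    rw [h1]
    -- Row `2` directly follows row `1`; from row `4` on, a block lies between consecutive powers of
    -- two.
    cases a with
    | zero =>
      have := ih (by omega)
      simp only [zero_add, pow_zero, pow_one] at this ⊢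
      rw [show 2 - 1 = 1 from rfl, this]
      by_cases h0 : i = 0
      · subst h0; simp
      · by_cases h1 : i = 1
        · subst h1; simp
        · have : ¬ i ≤ 1 := by omega
          simp [h0, this, Ne.symm h1]
    | succ m =>
      rw [above_full_block w (by omega), ih (by omega)]
      have two : (1 : ZMod 2) + 1 = 0 := CharTwo.add_self_eq_zero 1
      split_ifs <;> first | omega | simp [two]

theorem above_last (hi : i ≤ k) :
    above w 0 (2 ^ (k + 1) - 1) = if i = k then 1 else 0 := by
  have two : (1 : ZMod 2) + 1 = 0 := CharTwo.add_self_eq_zero 1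
  obtain _ | k := k
  · have := above_pow w (a := 0) le_rfl
    simp at this ⊢
    rw [this]
  · rw [above_full_block w (by omega), above_pow w le_rfl]
    split_ifs <;> first | omega | simp [two]

/-- No vertical edge leaves the bottom row, so the total parity is the same in all gaps. -/
theorem above_last_column {c : ℕ} (hi : i ≤ k) (hc : c ≤ L) :
    above w c (2 ^ (k + 1) - 1) = if i = k then 1 else 0 := by
  induction c with
  | zero => exact above_last w hi
  | succ c ih =>
    have h := above_add_above w (2 ^ (k + 1) - 1) hc (Or.inl rfl) (target_column k L i)
    rw [vcount_eq_zero_of_not_inBox w (Or.inr (by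
      have : 1 ≤ 2 ^ (k + 1) := Nat.one_le_two_pow
      simp [InBox]; omega))] at h
    rw [← CharTwo.add_eq_zero.1 h, ih (by omega)]

theorem above_mirror_last (hi : i < k) (d : ℕ) (hd : d < 2 ^ k) :
    above w L (2 ^ k + d) = above w L (2 ^ k - d - 1) + hcount w L (2 ^ k) := by
  have hv : ∀ r, (r, L + 1) ≠ target k L i := by
    intro r
    unfold target
    rw [if_neg hi.ne]
    simp
  exact above_symmetric w d hd fun j _ _ => hcount_last_symm w (by rw [pow_succ]; omega)
    (by simp) (hv _) (by simp) (hv _)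

end Strands

theorem walk_map_eq_of_edges {V α : Type*} {G : SimpleGraph V} {u v : V} (w : G.Walk u v)
    (f : V → α) (h : ∀ x y, s(x, y) ∈ w.edges → f x = f y) : ∀ p ∈ w.support, f p = f u := by
  induction w with
  | nil => simp
  | cons h' w ih =>
    intro p hp
    rw [Walk.support_cons, List.mem_cons] at hp
    rcases hp with rfl | hp
    · rfl
    · rw [ih (fun x y hxy => h x y (by simp [hxy])) p hp]
      exact (h _ _ (Walk.edges_cons h' w ▸ List.mem_cons_self)).symm

/-- The side of a strand is the same at both ends of an edge that avoids the strand, unless the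
edge is an arc around the target of the strand. -/
theorem above_eq_of_adj {k L i : ℕ} (hi : i < k) (w : (foldGraph k L).Walk (2 ^ i, 0) (target k L i))
    {p q : ℕ × ℕ} (h : (foldGraph k L).Adj p q) (hp : p ∉ w.support) (hq : q ∉ w.support)
    (hA : p.2 = 0 → q.2 = 0 → ¬ Mirror i p.1 q.1) :
    above w (min p.2 L) p.1 = above w (min q.2 L) q.1 := by
  -- There is no gap to the right of column `L + 1`, so `min` assigns gap `L` to both of the last
  -- two columns.
  have horizontal : ∀ r c, c ≤ L → (r, c) ∉ w.support → (r, c + 1) ∉ w.support →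
      above w (min c L) r = above w (min (c + 1) L) r := by
    intro r c hc h1 h2
    rcases hc.eq_or_lt with rfl | hc
    · simp
    · have h3 := above_add_above w r hc (Or.inl rfl) (target_column k L i)
      rw [vcount_eq_zero_top w h2] at h3
      rw [min_eq_left hc.le, min_eq_left (Nat.succ_le_of_lt hc)]
      exact CharTwo.add_eq_zero.1 h3
  have vertical : ∀ r c, c ≤ L → (r + 1, c) ∉ w.support → above w c r = above w c (r + 1) := by
    intro r c hc h1
    rw [above_succ, hcount_eq_zero_left w h1, add_zero]
  -- Row `r'` is not crossed, the rows strictly between `r` and `r'` cancel about the centre, and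
  -- the centre itself is crossed oddly only if `m = i`.
  have left : ∀ r r' m, m ≠ i → m < k → r < r' → Mirror m r r' → (r', 0) ∉ w.support →
      above w 0 r = above w 0 r' := by
    intro r r' m hm hmk hlt hM h1
    obtain ⟨d, hd, rfl, rfl⟩ : ∃ d, d < 2 ^ m ∧ r = 3 * 2 ^ m - (d + 1) + 0 ∧
        r' = 3 * 2 ^ m + d + 1 := by
      obtain ⟨h1, h2, h3⟩ := hM
      rw [pow_succ] at *
      exact ⟨r' - 3 * 2 ^ m - 1, by omega, by omega, by omega⟩
    rw [above_succ, hcount_eq_zero_left w h1, above_block w m d hd, hcount_center w hmk, if_neg hm]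
    simp [Nat.sub_sub]
  have right : ∀ r r', r < r' → r + r' = 2 ^ (k + 1) → 1 ≤ r → (r', L + 1) ∉ w.support →
      above w L r = above w L r' := by
    intro r r' hlt hr hr1 h1
    obtain ⟨d, hd, rfl, rfl⟩ : ∃ d, d < 2 ^ k ∧ r = 2 ^ k - (d + 1) + 0 ∧
        r' = 2 ^ k + d + 1 := by
      rw [pow_succ] at *
      exact ⟨r' - 2 ^ k - 1, by omega, by omega, by omega⟩
    -- The vertex `(2 ^ k, L + 1)` has degree one and is a terminal of strand `k` only.
    have hc : hcount w L (2 ^ k) = 0 := by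
      have h0 : 0 < 2 ^ k := by positivity
      have h2 := above_mirror_last w hi 0 h0
      have h3 := walk_sum_count_edges w (2 ^ k, L + 1) {(2 ^ k, L)} (by
        rintro ⟨c, e⟩ ⟨h0, h0', (⟨h, h'⟩ | ⟨h, -⟩ | ⟨h, h', h2, h3⟩) | ⟨-, -, h2, -⟩⟩
        · simp [InBox] at *; omega
        · simp at h
        · simp only [pow_succ] at h3 h2; omega
        · simp at h2)
      rw [Finset.sum_singleton, Sym2.eq_swap, if_neg (by simp), if_neg (by
        unfold target; rw [if_neg hi.ne]; simp)] at h3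
      exact h3.trans (add_zero _)
    rw [above_succ, hcount_eq_zero_right w h1, above_mirror_last w hi d hd, hc]
    simp [Nat.sub_sub]
  obtain ⟨r, c⟩ := p
  obtain ⟨r', c'⟩ := q
  obtain ⟨hb, hb', (⟨h1, h2⟩ | ⟨h1, h2, h3, m, h4⟩ | ⟨h1, h2, h3, h4⟩) | ⟨h1, h2, h3, h4⟩⟩ := h
  · simp only [InBox] at h1 h2 hb hb'
    subst h1
    rcases h2 with rfl | rfl
    · exact horizontal r c (by omega) hp hq
    · exact (horizontal r c' (by omega) hq hp).symm
  · simp only at h1 h2 h3 h4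
    subst h1 h2
    have hm : m ≠ i := by
      rintro rfl
      exact hA rfl rfl h4
    have hmk : m < k := by
      have := h4.1.trans hb.2.1
      rw [Nat.pow_lt_pow_iff_right (by norm_num)] at this
      omega
    simp only [Nat.zero_min]
    rcases lt_or_gt_of_ne h3 with h | h
    · exact left r r' m hm hmk h h4 hq
    · exact (left r' r m hm hmk h h4.symm hp).symm
  · simp only at h1 h2 h3 h4
    subst h1 h2
    rw [min_eq_right (Nat.le_succ L)]
    rcases lt_or_gt_of_ne h3 with h | h
    · exact right r r' h h4 hb.1 hq
    · exact (right r' r h (by omega) hb'.1 hp).symm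
  · simp only at h1 h2 h3 h4
    subst h1
    rw [min_eq_left h3]
    rcases h4 with rfl | rfl
    · exact vertical r c h3 hq
    · exact (vertical r' c h3 hp).symm

/-! ### Counting the crossings of a family of disjoint walks -/

section Solution

variable {k L : ℕ} (W : ∀ i : Fin (k + 1), (foldGraph k L).Walk (2 ^ (i : ℕ), 0) (target k L i))

/-- All vertices of a later strand `a` are on the same side of strand `i`, which depends only on
whether `a = i + 1`. -/
theorem above_of_mem_support (hW : ∀ i j, i ≠ j → ∀ v, v ∈ (W i).support → v ∉ (W j).support)
    {i a : Fin (k + 1)} (hia : i < a)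
    (hA : ∀ r r', Mirror i r r' → r < r' → (r, 0) ∉ (W a).support) (p : ℕ × ℕ)
    (hp : p ∈ (W a).support) :
    above (W i) (min p.2 L) p.1 = if (a : ℕ) = i + 1 then 1 else 0 := by
  have hi : (i : ℕ) < k := by omega
  -- The side is constant along walk `a`, so it can be read off at the start, where `above_pow`
  -- gives it.
  rw [walk_map_eq_of_edges (W a) (fun p => above (W i) (min p.2 L) p.1) ?_ p hp]
  · simp only [Nat.zero_min]
    rw [above_pow (W i) (by omega), if_pos (by omega)]
    split_ifs <;> first | omega | rfl
  · rintro ⟨r, c⟩ ⟨r', c'⟩ hxy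
    have hx := (W a).fst_mem_support_of_mem_edges hxy
    have hy := (W a).snd_mem_support_of_mem_edges hxy
    refine above_eq_of_adj hi (W i) ((W a).adj_of_mem_edges hxy) (hW a i hia.ne' _ hx)
      (hW a i hia.ne' _ hy) ?_
    simp only
    rintro rfl rfl hM
    rcases lt_trichotomy r r' with h | rfl | h
    · exact hA r r' hM h hx
    · exact ((W a).adj_of_mem_edges hxy).ne rfl
    · exact hA r' r hM.symm h hy

theorem exists_hcount_ne_zero {u v : ℕ × ℕ} (w : (foldGraph k L).Walk u v) {c r₀ r₁ : ℕ}
    (h01 : r₀ ≤ r₁) (h : above w c r₀ ≠ above w c r₁) :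
    ∃ r, r₀ < r ∧ r ≤ r₁ ∧ hcount w c r ≠ 0 := by
  induction r₁, h01 using Nat.le_induction with
  | base => exact absurd rfl h
  | succ r₁ h01 ih =>
    by_cases h' : hcount w c (r₁ + 1) = 0
    · rw [above_succ, h', add_zero] at h
      obtain ⟨r, h1, h2, h3⟩ := ih h
      exact ⟨r, h1, by omega, h3⟩
    · exact ⟨r₁ + 1, by omega, le_rfl, h'⟩

open Classical in
/-- The rows in `(r₀, r₁]` in which one of the first `n` strands passes from column `c` to column
`c + 1`. -/
noncomputable def crossings (c n r₀ r₁ : ℕ) : Finset ℕ :=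
  {r ∈ Finset.Ioc r₀ r₁ | ∃ a : Fin (k + 1), (a : ℕ) < n ∧ hcount (W a) c r ≠ 0}

/-- A crossing row of the last strand splits the range in two. In both parts the preceding strand
changes its side, so the induction gives `2 * (2 ^ n - 1) + 1` crossings for `n + 1` strands. -/
theorem card_crossings (hW : ∀ i j, i ≠ j → ∀ v, v ∈ (W i).support → v ∉ (W j).support)
    (c n : ℕ) (hn : n ≤ k + 1)
    (hF : ∀ i a : Fin (k + 1), i < a → (a : ℕ) < n → ∀ r, hcount (W a) c r ≠ 0 →
      above (W i) c r = if (a : ℕ) = i + 1 then 1 else 0)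
    (r₀ r₁ : ℕ) (h01 : r₀ ≤ r₁)
    (h₀ : ∀ i : Fin (k + 1), (i : ℕ) + 1 < n → above (W i) c r₀ = 0)
    (h₁ : ∀ i : Fin (k + 1), (i : ℕ) + 1 < n → above (W i) c r₁ = 0)
    (hne : ∀ i : Fin (k + 1), (i : ℕ) + 1 = n → above (W i) c r₀ ≠ above (W i) c r₁) :
    2 ^ n ≤ (crossings W c n r₀ r₁).card + 1 := by
  induction n generalizing r₀ r₁ with
  | zero => simp
  | succ n ih =>
    let b : Fin (k + 1) := ⟨n, hn⟩
    obtain ⟨r, hr0, hr1, hr⟩ := exists_hcount_ne_zero (W b) h01 (hne b rfl)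
    obtain ⟨r, rfl⟩ : ∃ r', r = r' + 1 := ⟨r - 1, by omega⟩
    have top : ∀ i : Fin (k + 1), i < b → above (W i) c (r + 1) = if n = i + 1 then 1 else 0 :=
      fun i hi => hF i b hi (Nat.lt_succ_self n) _ hr
    -- By disjointness, strand `i` does not use the crossing row, so its parity is the same just
    -- above it.
    have bot : ∀ i : Fin (k + 1), i < b → above (W i) c r = if n = i + 1 then 1 else 0 := by
      intro i hi
      rw [← top i hi, above_succ, hcount_eq_zero_left, add_zero]
      exact hW b i hi.ne' _ (mem_support_of_hcount_ne_zero _ hr).1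
    have lt_b : ∀ i : Fin (k + 1), (i : ℕ) < n → i < b := fun i hi => hi
    have i1 := ih (by omega) (fun i a hia ha => hF i a hia (by omega)) r₀ r (by omega)
      (fun i hi => h₀ i (by omega))
      (fun i hi => by rw [bot i (lt_b i (by omega)), if_neg (by omega)])
      (fun i hi => by
        rw [bot i (lt_b i (by omega)), if_pos hi.symm, h₀ i (by omega)]; exact zero_ne_one)
    have i2 := ih (by omega) (fun i a hia ha => hF i a hia (by omega)) (r + 1) r₁ (by omega)
      (fun i hi => by rw [top i (lt_b i (by omega)), if_neg (by omega)])
      (fun i hi => h₁ i (by omega))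
      (fun i hi => by
        rw [top i (lt_b i (by omega)), if_pos hi.symm, h₁ i (by omega)]; exact one_ne_zero)
    have hsub : insert (r + 1) (crossings W c n r₀ r ∪ crossings W c n (r + 1) r₁) ⊆
        crossings W c (n + 1) r₀ r₁ := by
      intro x hx
      simp only [crossings, Finset.mem_insert, Finset.mem_union, Finset.mem_filter,
        Finset.mem_Ioc] at hx ⊢
      rcases hx with rfl | ⟨hx, a, ha, hx'⟩ | ⟨hx, a, ha, hx'⟩
      · exact ⟨⟨hr0, hr1⟩, b, Nat.lt_succ_self n, hr⟩
      · exact ⟨by omega, a, by omega, hx'⟩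
      · exact ⟨by omega, a, by omega, hx'⟩
    have hcard := Finset.card_le_card hsub
    rw [Finset.card_insert_of_notMem (by simp [crossings]), Finset.card_union_of_disjoint (by
      rw [Finset.disjoint_left]
      intro x hx hx'
      simp only [crossings, Finset.mem_filter, Finset.mem_Ioc] at hx hx'
      omega)] at hcard
    rw [pow_succ]
    omega

theorem forall_of_card_crossings {c n r₀ r₁ : ℕ} (h : r₁ ≤ (crossings W c n r₀ r₁).card + r₀)
    {r : ℕ} (h0 : r₀ < r) (h1 : r ≤ r₁) :
    ∃ a : Fin (k + 1), (a : ℕ) < n ∧ hcount (W a) c r ≠ 0 := by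
  have heq : crossings W c n r₀ r₁ = Finset.Ioc r₀ r₁ :=
    Finset.eq_of_subset_of_card_le (Finset.filter_subset _ _) (by rw [Nat.card_Ioc]; omega)
  have : r ∈ crossings W c n r₀ r₁ := by rw [heq]; simp [h0, h1]
  exact (Finset.mem_filter.1 this).2

/-- The arcs around the target of strand `j` are taken by the strands before `j`. -/
theorem arcs_taken (hW : ∀ i j, i ≠ j → ∀ v, v ∈ (W i).support → v ∉ (W j).support) (j : ℕ)
    (hj : j < k) : ∀ b : Fin (k + 1), j ≤ b → ∀ r r', Mirror j r r' → r < r' →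
      (r, 0) ∉ (W b).support := by
  induction j using Nat.strong_induction_on with
  | _ j ih =>
    have hside : ∀ i a : Fin (k + 1), i < a → (i : ℕ) < j → ∀ p ∈ (W a).support,
        above (W i) (min p.2 L) p.1 = if (a : ℕ) = i + 1 then 1 else 0 :=
      fun i a hia hi => above_of_mem_support W hW hia (ih i hi (by omega) a hia.le)
    have h2 : 0 < 2 ^ j := by positivity
    -- Strand `j` ends in row `3 * 2 ^ j`, where its side is known by induction; an earlier strand
    -- crosses that row with even parity, so the side is the same one row above.
    have hend : ∀ i : Fin (k + 1), (i : ℕ) < j →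
        above (W i) 0 (3 * 2 ^ j - 1) = if j = i + 1 then 1 else 0 := by
      intro i hi
      have h := hside i ⟨j, by omega⟩ hi hi (3 * 2 ^ j, 0) (by
        have : target k L j = (3 * 2 ^ j, 0) := if_neg hj.ne
        rw [← this]
        exact Walk.end_mem_support _)
      simp only [Nat.zero_min] at h
      have h' := above_succ (W i) 0 (3 * 2 ^ j - 1)
      rw [Nat.sub_add_cancel (by omega), h, hcount_center _ hj, if_neg hi.ne', add_zero] at h'
      exact h'.symm
    have two : (1 : ZMod 2) + 1 = 0 := CharTwo.add_self_eq_zero 1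
    have hstart : ∀ i : Fin (k + 1), (i : ℕ) < j → above (W i) 0 (2 ^ (j + 1)) = 0 := by
      intro i hi
      rw [above_pow (W i) (by omega), if_pos (by omega), if_pos (by omega), two]
    -- The range contains exactly `2 ^ j - 1` rows, as many as the crossings that the first `j`
    -- strands need.
    have hcard := card_crossings W hW 0 j (by omega)
      (fun i a hia ha r hr => by
        simpa using hside i a hia (lt_trans hia ha) (r, 0) (mem_support_of_hcount_ne_zero _ hr).1)
      (2 ^ (j + 1)) (3 * 2 ^ j - 1) (by rw [pow_succ]; omega)
      (fun i hi => hstart i (by omega))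
      (fun i hi => by rw [hend i (by omega), if_neg (by omega)])
      (fun i hi => by
        rw [hend i (by omega), if_pos hi.symm, hstart i (by omega)]; exact zero_ne_one)
    intro b hb r r' hM hlt hmem
    obtain ⟨a, ha, ha'⟩ := forall_of_card_crossings W (r := r) (r₀ := 2 ^ (j + 1))
      (r₁ := 3 * 2 ^ j - 1) (c := 0) (n := j) (by rw [pow_succ] at hcard ⊢; omega) hM.1 (by
      have := hM.2.2
      rw [pow_succ] at this
      omega)
    exact hW b a (by rintro rfl; omega) _ hmem (mem_support_of_hcount_ne_zero _ ha').1

/-- Every horizontal edge is used. -/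
theorem horizontal_taken (hW : ∀ i j, i ≠ j → ∀ v, v ∈ (W i).support → v ∉ (W j).support)
    {c r : ℕ} (hc : c ≤ L) (hr : 1 ≤ r) (hr' : r < 2 ^ (k + 1)) :
    ∃ a : Fin (k + 1), s((r, c), (r, c + 1)) ∈ (W a).edges := by
  -- Over the full column only strand `k` has odd total parity, as the count requires.
  have hcard := card_crossings W hW c (k + 1) le_rfl
    (fun i a hia _ r hr => by
      have := above_of_mem_support W hW hia (arcs_taken W hW i (by omega) a hia.le) (r, c)
        (mem_support_of_hcount_ne_zero _ hr).1
      simpa [min_eq_left hc] using this)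
    0 (2 ^ (k + 1) - 1) (Nat.zero_le _) (fun i _ => above_zero _ _)
    (fun i hi => by rw [above_last_column _ (by omega) hc, if_neg (by omega)])
    (fun i hi => by
      rw [above_last_column _ (by omega) hc, if_pos (by omega), above_zero]; exact zero_ne_one)
  obtain ⟨a, -, ha⟩ := forall_of_card_crossings W (r := r) (r₀ := 0) (r₁ := 2 ^ (k + 1) - 1)
    (c := c) (n := k + 1) (by omega) hr (by omega)
  exact ⟨a, mem_edges_of_count_ne_zero ha⟩

theorem mem_support_of_inBox (hW : ∀ i j, i ≠ j → ∀ v, v ∈ (W i).support → v ∉ (W j).support)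
    {p : ℕ × ℕ} (hp : InBox k L p) : ∃ a : Fin (k + 1), p ∈ (W a).support := by
  obtain ⟨r, c⟩ := p
  obtain ⟨h1, h2, h3⟩ := hp
  simp only at h1 h2 h3
  rcases h3.eq_or_lt with rfl | h3
  · obtain ⟨a, ha⟩ := horizontal_taken W hW le_rfl h1 h2
    exact ⟨a, Walk.snd_mem_support_of_mem_edges _ ha⟩
  · obtain ⟨a, ha⟩ := horizontal_taken W hW (Nat.lt_succ_iff.1 h3) h1 h2
    exact ⟨a, Walk.fst_mem_support_of_mem_edges _ ha⟩

/-- Both horizontal edges at an end of a vertical edge are used, by disjointness by the same path; a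
path has no three edges at a vertex. -/
theorem strandAdj_of_mem_edges (hW : ∀ i j, i ≠ j → ∀ v, v ∈ (W i).support → v ∉ (W j).support)
    (hpath : ∀ i, (W i).IsPath) (a : Fin (k + 1)) (x y : ℕ × ℕ) (hxy : s(x, y) ∈ (W a).edges) :
    StrandAdj k L x y := by
  obtain ⟨hx, hy, h | h⟩ := (W a).adj_of_mem_edges hxy
  · exact h
  · exfalso
    obtain ⟨r, c⟩ := x
    obtain ⟨r', c'⟩ := y
    obtain ⟨h1, h2, h3, h4⟩ := h
    simp only [InBox] at h1 h2 h3 h4 hx hy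
    subst h1
    obtain ⟨c, rfl⟩ := Nat.exists_eq_add_of_le' h2
    have hs := (W a).fst_mem_support_of_mem_edges hxy
    have same : ∀ e, (r, c + 1) ∈ e → ∀ b, e ∈ (W b).edges → e ∈ (W a).edges := by
      intro e he b hb
      by_cases hab : a = b
      · rwa [hab]
      · exact absurd ((W b).mem_support_of_mem_edges hb he) (hW a b hab _ hs)
    obtain ⟨b, hb⟩ := horizontal_taken W hW (c := c) (by omega) hx.1 hx.2.1
    obtain ⟨b', hb'⟩ := horizontal_taken W hW h3 hx.1 hx.2.1
    have e1 := same _ (by simp) _ hb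
    have e2 := same _ (by simp) _ hb'
    rw [Sym2.eq_swap] at e1
    have := path_not_three_edges (W a) (hpath a) hxy e1 e2
    simp at this
    omega

end Solution

/-! ### A plane drawing of the folded grid -/

/-- The vertex in row `r` and column `c` is drawn at the point `(c, r)`. -/
def drawPoint (p : ℕ × ℕ) : ℝ × ℝ := ((p.2 : ℝ), (p.1 : ℝ))

/-- The direction in which the vertical distance between two vertices is bent. -/
def bend (L c : ℕ) : ℝ := if c = 0 then -1 else if c = L + 1 then 1 else 0

/-- Horizontal and vertical edges are drawn as segments, and arcs as two diagonal segments. -/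
noncomputable def drawCurve (L : ℕ) (p q : ℕ × ℕ) (t : ℝ) : ℝ × ℝ :=
  ((1 - t) * p.2 + t * q.2 + bend L p.2 * (|(p.1 : ℝ) - q.1| / 2 * (1 - |2 * t - 1|)),
    (1 - t) * p.1 + t * q.1)

theorem drawCurve_zero (L : ℕ) (p q : ℕ × ℕ) : drawCurve L p q 0 = drawPoint p := by
  simp [drawCurve, drawPoint]

theorem drawCurve_one (L : ℕ) (p q : ℕ × ℕ) : drawCurve L p q 1 = drawPoint q := by
  norm_num [drawCurve, drawPoint]

theorem drawPoint_injective : Function.Injective drawPoint := by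
  rintro ⟨a, b⟩ ⟨c, d⟩ h
  simp only [drawPoint, Prod.mk.injEq, Nat.cast_inj] at h
  rw [h.1, h.2]

theorem continuous_drawCurve (L : ℕ) (p q : ℕ × ℕ) : Continuous (drawCurve L p q) := by
  unfold drawCurve
  fun_prop

theorem row_eq_or_column_eq {k L : ℕ} {p q : ℕ × ℕ} (h : (foldGraph k L).Adj p q) :
    p.1 = q.1 ∨ p.2 = q.2 := by
  obtain ⟨-, -, (⟨h, -⟩ | ⟨h, h', -⟩ | ⟨h, h', -⟩) | ⟨h, -⟩⟩ := h
  · exact Or.inl h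
  · exact Or.inr (h.trans h'.symm)
  · exact Or.inr (h.trans h'.symm)
  · exact Or.inr h

/-- Edges are unordered; reversing the chosen direction only reverses the parameter. -/
theorem drawCurve_swap {k L : ℕ} {p q : ℕ × ℕ} (h : (foldGraph k L).Adj p q) (t : ℝ) :
    drawCurve L q p (1 - t) = drawCurve L p q t := by
  have h1 : |2 * (1 - t) - 1| = |2 * t - 1| := by
    rw [← abs_neg]; ring_nf
  unfold drawCurve
  rw [h1, abs_sub_comm (q.1 : ℝ)]
  rcases row_eq_or_column_eq h with h | h <;> rw [h] <;> ext <;> simp <;> ring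

theorem drawCurve_injective {k L : ℕ} {p q : ℕ × ℕ} (h : (foldGraph k L).Adj p q) :
    Function.Injective (drawCurve L p q) := by
  intro t t' htt
  obtain ⟨h1, h2⟩ := Prod.ext_iff.1 htt
  simp only [drawCurve] at h1 h2
  have hne : p.1 ≠ q.1 ∨ p.2 ≠ q.2 := by
    by_contra! hn
    exact h.ne (Prod.ext hn.1 hn.2)
  by_cases hr : p.1 = q.1
  · have hc : (q.2 : ℝ) - p.2 ≠ 0 := by
      rw [sub_ne_zero]
      exact_mod_cast (hne.resolve_left (not_not.2 hr)).symm
    simp only [hr, sub_self, abs_zero, zero_div, zero_mul, mul_zero, add_zero] at h1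
    exact mul_left_cancel₀ hc (by linear_combination h1)
  · have hc : (q.1 : ℝ) - p.1 ≠ 0 := by
      rw [sub_ne_zero]
      exact_mod_cast (Ne.symm hr)
    exact mul_left_cancel₀ hc (by linear_combination h2)

/-- What lies on the interior of the curve of an edge. -/
def OnEdge (k L : ℕ) (e : Sym2 (ℕ × ℕ)) (z : ℝ × ℝ) : Prop :=
  (∃ r c : ℕ, e = s((r, c), (r, c + 1)) ∧ c ≤ L ∧ z.2 = r ∧ c < z.1 ∧ z.1 < c + 1) ∨
  (∃ r c : ℕ, e = s((r, c), (r + 1, c)) ∧ c ≤ L ∧ z.1 = c ∧ r < z.2 ∧ z.2 < r + 1) ∨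
  (∃ r r' m : ℕ, e = s((r, 0), (r', 0)) ∧ Mirror m r r' ∧ z.1 < 0 ∧ r < z.2 ∧ z.2 < r' ∧
    |2 * z.2 - 3 * 2 ^ (m + 1)| - 2 * z.1 = r' - r) ∨
  (∃ r r' : ℕ, e = s((r, L + 1), (r', L + 1)) ∧ r + r' = 2 ^ (k + 1) ∧ L + 1 < z.1 ∧
    |2 * z.2 - 2 ^ (k + 1)| + 2 * (z.1 - (L + 1)) = r' - r)

theorem onEdge_drawCurve {k L : ℕ} {p q : ℕ × ℕ} (h : (foldGraph k L).Adj p q) {t : ℝ}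
    (h0 : 0 < t) (h1 : t < 1) : OnEdge k L s(p, q) (drawCurve L p q t) := by
  have hpos : 0 < 1 - |2 * t - 1| := by
    rw [sub_pos, abs_lt]; constructor <;> linarith
  -- it suffices to treat edges that go down or to the right
  have oriented : ∀ {p q : ℕ × ℕ} {t : ℝ}, (foldGraph k L).Adj p q → 0 < t → t < 1 →
      0 < 1 - |2 * t - 1| →
      p.1 < q.1 ∨ (p.1 = q.1 ∧ p.2 < q.2) → OnEdge k L s(p, q) (drawCurve L p q t) := by
    rintro ⟨r, c⟩ ⟨r', c'⟩ t ⟨hb, hb', h⟩ h0 h1 hpos hlt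
    simp only [InBox] at hb hb' hlt
    obtain (⟨h2, h3⟩ | ⟨h2, h3, h4, m, h5⟩ | ⟨h2, h3, h4, h5⟩) | ⟨h2, h3, h4, h5⟩ := h
    · simp only at h2 h3
      subst h2
      obtain rfl : c + 1 = c' := by omega
      refine Or.inl ⟨r, c, rfl, by omega, ?_⟩
      simp only [drawCurve, sub_self, abs_zero, zero_div, zero_mul, mul_zero, add_zero]
      push_cast
      exact ⟨by ring, by linarith, by linarith⟩
    · simp only at h2 h3 h4 h5
      subst h2 h3
      have hlt' : (r : ℝ) < r' := by exact_mod_cast (by omega : r < r')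
      have hs : (r : ℝ) + r' = 3 * 2 ^ (m + 1) := by exact_mod_cast h5.2.2
      refine Or.inr (Or.inr (Or.inl ⟨r, r', m, rfl, h5, ?_⟩))
      simp only [drawCurve, bend, if_true]
      rw [abs_of_neg (sub_neg.2 hlt'), ← hs]
      refine ⟨?_, by nlinarith, by nlinarith, ?_⟩
      · have := mul_pos (half_pos (sub_pos.2 hlt')) hpos
        push_cast
        linarith
      · have : 2 * ((1 - t) * (r : ℝ) + t * r') - (r + r') = (r' - r) * (2 * t - 1) := by ring
        rw [this, abs_mul, abs_of_pos (sub_pos.2 hlt')]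
        push_cast
        ring
    · simp only at h2 h3 h4 h5
      subst h2 h3
      have hlt' : (r : ℝ) < r' := by exact_mod_cast (by omega : r < r')
      have hs : (r : ℝ) + r' = 2 ^ (k + 1) := by exact_mod_cast h5
      refine Or.inr (Or.inr (Or.inr ⟨r, r', rfl, h5, ?_⟩))
      simp only [drawCurve, bend, if_true]
      rw [abs_of_neg (sub_neg.2 hlt'), ← hs, if_neg (Nat.succ_ne_zero L)]
      constructor
      · have := mul_pos (half_pos (sub_pos.2 hlt')) hpos
        push_cast
        linarith
      · have : 2 * ((1 - t) * (r : ℝ) + t * r') - (r + r') = (r' - r) * (2 * t - 1) := by ring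
        rw [this, abs_mul, abs_of_pos (sub_pos.2 hlt')]
        push_cast
        ring
    · simp only at h2 h3 h4 h5
      subst h2
      obtain rfl : r + 1 = r' := by omega
      refine Or.inr (Or.inl ⟨r, c, rfl, h4, ?_⟩)
      simp only [drawCurve, bend]
      rw [if_neg (by omega), if_neg (by omega)]
      push_cast
      exact ⟨by ring, by linarith, by linarith⟩
  by_cases hlt : p.1 < q.1 ∨ (p.1 = q.1 ∧ p.2 < q.2)
  · exact oriented h h0 h1 hpos hlt
  · have hne : p.1 ≠ q.1 ∨ p.2 ≠ q.2 := by
      by_contra! hn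
      exact h.ne (Prod.ext hn.1 hn.2)
    rw [← drawCurve_swap h, Sym2.eq_swap]
    refine oriented h.symm (by linarith) (by linarith) ?_ (by omega)
    rwa [show 2 * (1 - t) - 1 = -(2 * t - 1) by ring, abs_neg]

theorem not_onEdge_drawPoint {k L : ℕ} {e : Sym2 (ℕ × ℕ)} {p : ℕ × ℕ} (hp : p.2 ≤ L + 1) :
    ¬ OnEdge k L e (drawPoint p) := by
  rintro (⟨r, c, -, -, -, h1, h2⟩ | ⟨r, c, -, -, -, h1, h2⟩ | ⟨r, r', m, -, -, h, -⟩ |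
    ⟨r, r', -, -, h, -⟩)
  · simp only [drawPoint] at h1 h2
    norm_cast at h1 h2
    omega
  · simp only [drawPoint] at h1 h2
    norm_cast at h1 h2
    omega
  · simp only [drawPoint] at h
    norm_cast at h
  · simp only [drawPoint] at h
    norm_cast at h
    omega

/-- Grid edges are separated by integrality of coordinates, and arcs lie outside the strip of the
columns. Arcs with the same centre are halves of concentric diamonds, so a point determines the size
of its diamond. -/
theorem onEdge_unique {k L : ℕ} {e e' : Sym2 (ℕ × ℕ)} {z : ℝ × ℝ} (h : OnEdge k L e z)
    (h' : OnEdge k L e' z) : e = e' := by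
  have between : ∀ {a b : ℕ} {x : ℝ}, (a : ℝ) < x → x < a + 1 → (b : ℝ) < x → x < b + 1 →
      a = b := by
    intro a b x h1 h2 h3 h4
    have h5 : (a : ℝ) < b + 1 := by linarith
    have h6 : (b : ℝ) < a + 1 := by linarith
    norm_cast at h5 h6
    omega
  have integer : ∀ {a b : ℕ} {x : ℝ}, (a : ℝ) < x → x < a + 1 → x ≠ b := by
    rintro a b x h1 h2 rfl
    norm_cast at h1 h2
    omega
  have bound : ∀ {c : ℕ}, c ≤ L → (c : ℝ) + 1 ≤ L + 1 := fun hc => by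
    exact_mod_cast Nat.succ_le_succ hc
  have nonneg : ∀ c : ℕ, (0 : ℝ) ≤ c := fun c => Nat.cast_nonneg c
  rcases h with ⟨r, c, rfl, h1, h2, h3, h4⟩ | ⟨r, c, rfl, h1, h2, h3, h4⟩ |
    ⟨r, s, m, rfl, h1, h2, h3, h4, h5⟩ | ⟨r, s, rfl, h1, h2, h3⟩ <;>
  rcases h' with ⟨r', c', rfl, h1', h2', h3', h4'⟩ | ⟨r', c', rfl, h1', h2', h3', h4'⟩ |
    ⟨r', s', m', rfl, h1', h2', h3', h4', h5'⟩ | ⟨r', s', rfl, h1', h2', h3'⟩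
  · rw [between h3 h4 h3' h4', show r = r' by exact_mod_cast h2.symm.trans h2']
  · exact absurd h2' (integer h3 h4)
  · linarith [nonneg c]
  · linarith [bound h1]
  · exact absurd h2 (integer h3' h4')
  · rw [between h3 h4 h3' h4', show c = c' by exact_mod_cast h2.symm.trans h2']
  · linarith [nonneg c]
  · linarith [bound h1]
  · linarith [nonneg c']
  · linarith [nonneg c']
  · have hr : (2 : ℝ) ^ (m + 1) < z.2 := lt_trans (by exact_mod_cast h1.1) h3
    have hs : z.2 < (2 : ℝ) ^ (m + 2) := lt_trans h4 (by exact_mod_cast h1.symm.lt)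
    have hr' : (2 : ℝ) ^ (m' + 1) < z.2 := lt_trans (by exact_mod_cast h1'.1) h3'
    have hs' : z.2 < (2 : ℝ) ^ (m' + 2) := lt_trans h4' (by exact_mod_cast h1'.symm.lt)
    have e1 := (pow_lt_pow_iff_right₀ (by norm_num : (1 : ℝ) < 2)).1 (hr.trans hs')
    have e2 := (pow_lt_pow_iff_right₀ (by norm_num : (1 : ℝ) < 2)).1 (hr'.trans hs)
    -- The height of the point determines the block, hence the centre of the arc.
    obtain rfl : m = m' := by omega
    have e3 : (s : ℝ) - r = s' - r' := by rw [← h5, ← h5']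
    have e4 : s + r' = s' + r := by
      have : (s : ℝ) + r' = s' + r := by linarith
      exact_mod_cast this
    have e5 := h1.2.2
    have e6 := h1'.2.2
    rw [show r = r' by omega, show s = s' by omega]
  · linarith [nonneg L]
  · linarith [bound h1']
  · linarith [bound h1']
  · linarith [nonneg L]
  · have e3 : (s : ℝ) - r = s' - r' := by rw [← h3, ← h3']
    have e4 : s + r' = s' + r := by
      have : (s : ℝ) + r' = s' + r := by linarith
      exact_mod_cast this
    rw [show r = r' by omega, show s = s' by omega]

/-- The fold graph on its finite box of vertices. -/
def foldBox (k L : ℕ) : SimpleGraph {p : ℕ × ℕ | InBox k L p} :=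
  (foldGraph k L).induce {p | InBox k L p}

theorem isPlanarGraph_foldBox (k L : ℕ) : IsPlanarGraph (foldBox k L) := by
  have adj : ∀ e : (foldBox k L).edgeSet, (foldGraph k L).Adj e.1.out.1 e.1.out.2 := by
    intro e
    have h := e.2
    rw [← Quot.out_eq e.1] at h
    exact h
  have eq : ∀ e : (foldBox k L).edgeSet, e.1 = s(e.1.out.1, e.1.out.2) :=
    fun e => (Quot.out_eq e.1).symm
  have onEdge : ∀ (e : (foldBox k L).edgeSet) (x : unitInterval), x ∈ Set.Ioo (0 : unitInterval) 1 →
      OnEdge k L s((e.1.out.1 : ℕ × ℕ), e.1.out.2) (drawCurve L e.1.out.1 e.1.out.2 x) :=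
    fun e x hx => onEdge_drawCurve (adj e) hx.1 hx.2
  refine ⟨{
    point := fun p => drawPoint p
    curve := fun e x => drawCurve L e.1.out.1 e.1.out.2 x
    point_injective := drawPoint_injective.comp Subtype.val_injective
    curve_continuous := fun e => (continuous_drawCurve L _ _).comp continuous_subtype_val
    curve_injective := fun e => (drawCurve_injective (adj e)).comp Subtype.val_injective
    curve_ends := ?_
    interior_ne_point := ?_
    interior_notMem_curve := ?_ }⟩
  · intro e
    conv_rhs => rw [eq e]
    rw [Sym2.map_mk]
    simp only [Set.Icc.coe_zero, Set.Icc.coe_one, drawCurve_zero, drawCurve_one]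
  · intro e x hx v h
    have := onEdge e x hx
    rw [h] at this
    exact not_onEdge_drawPoint v.2.2.2 this
  · rintro e x hx e' hne ⟨y, hy⟩
    have h := onEdge e x hx
    simp only at hy
    rw [← hy] at h
    by_cases h0 : y = 0
    · subst h0
      rw [Set.Icc.coe_zero, drawCurve_zero] at h
      exact not_onEdge_drawPoint e'.1.out.1.2.2.2 h
    by_cases h1 : y = 1
    · subst h1
      rw [Set.Icc.coe_one, drawCurve_one] at h
      exact not_onEdge_drawPoint e'.1.out.2.2.2.2 h
    have h' := onEdge e' y ⟨unitInterval.pos_iff_ne_zero.2 h0, unitInterval.lt_one_iff_ne_one.2 h1⟩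
    have h2 := onEdge_unique h' h
    refine hne (Subtype.ext ?_)
    rw [eq e', eq e]
    exact Sym2.map.injective Subtype.val_injective h2

/-! ### The square grid as a subgraph -/

theorem isContained_foldBox {n k L : ℕ} (hn : n < 2 ^ (k + 1)) (hL : n ≤ L) :
    (gridGraph n n).IsContained (foldBox k L) := by
  -- The shift by one skips row `0`, which is not in the box, and column `0`, which has no vertical
  -- edges.
  have box : ∀ p : Fin n × Fin n, InBox k L (p.1 + 1, p.2 + 1) := fun p =>
    ⟨by simp, by simp only; omega, by simp only; omega⟩
  refine ⟨⟨⟨fun p => ⟨(p.1 + 1, p.2 + 1), box p⟩, ?_⟩, ?_⟩⟩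
  · rintro p q h
    have : (foldGraph k L).Adj ((p.1 : ℕ) + 1, (p.2 : ℕ) + 1) ((q.1 : ℕ) + 1, (q.2 : ℕ) + 1) := by
      refine ⟨box p, box q, ?_⟩
      simp only [StrandAdj, VerticalAdj]
      rcases h with ⟨h1, h2⟩ | ⟨h1, h2⟩
      · rw [abs_eq (by norm_num)] at h2
        exact Or.inl (Or.inl ⟨by rw [h1], by omega⟩)
      · rw [abs_eq (by norm_num)] at h1
        exact Or.inr ⟨by rw [h2], by omega, by omega, by omega⟩
    exact this
  · intro p q h
    obtain ⟨h1, h2⟩ := Prod.ext_iff.1 (congrArg Subtype.val h)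
    exact Prod.ext (Fin.ext (Nat.succ_injective h1)) (Fin.ext (Nat.succ_injective h2))

/-! ### Existence of a solution: strands and 2-adic levels -/

theorem isHub_iff {r : ℕ} (hr : 1 ≤ r) (h : IsHub r) : ∃ j, r = 2 ^ j ∨ r = 3 * 2 ^ j := by
  have h1 := Nat.pow_log_le_self 2 (by omega : r ≠ 0)
  have h2 := Nat.lt_pow_succ_log_self (by norm_num : 1 < 2) r
  rcases h1.eq_or_lt with h1 | h1
  · exact ⟨_, Or.inl h1.symm⟩
  · generalize Nat.log 2 r = n at h1 h2
    obtain _ | j := n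
    · simp at h1 h2; omega
    · have hm : Mirror j r (3 * 2 ^ (j + 1) - r) := by
        unfold Mirror
        rw [Nat.succ_eq_add_one, pow_succ _ (j + 1)] at h2
        omega
      have := h j _ hm
      rw [pow_succ] at this
      exact ⟨j, Or.inr (by omega)⟩

/-- A vertex at which a strand ends. -/
def IsStrandEnd (k L : ℕ) (p : ℕ × ℕ) : Prop :=
  (p.2 = 0 ∧ IsHub p.1) ∨ p = (2 ^ k, L + 1)

theorem exists_pair_of_not_isStrandEnd {k L : ℕ} {p : ℕ × ℕ} (hp : InBox k L p)
    (h : ¬ IsStrandEnd k L p) :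
    ∃ a b, InBox k L a ∧ InBox k L b ∧ a ≠ b ∧
      ∀ q, InBox k L q → (StrandAdj k L p q ↔ q = a ∨ q = b) := by
  obtain ⟨r, c⟩ := p
  obtain ⟨h1, h2, h3⟩ := hp
  simp only [IsStrandEnd, not_or, not_and, Prod.mk.injEq] at h h1 h2 h3
  by_cases hc : c = 0
  · subst hc
    have := h.1 rfl
    simp only [IsHub, not_forall] at this
    obtain ⟨m, r', hM, hne⟩ := this
    have hmk : m < k := by
      have := hM.1.trans h2
      rw [Nat.pow_lt_pow_iff_right (by norm_num)] at this
      omega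
    have hr' : r' < 2 ^ (k + 1) :=
      hM.symm.lt.trans_le (Nat.pow_le_pow_right (by norm_num) (by omega))
    have hr0 : 1 ≤ r' := (Nat.zero_le _).trans_lt hM.2.1
    refine ⟨(r, 1), (r', 0), ⟨h1, h2, by simp⟩, ⟨hr0, hr', by simp⟩, by simp, ?_⟩
    rintro ⟨a, b⟩ -
    simp only [StrandAdj, Prod.mk.injEq]
    constructor
    · rintro (⟨h4, h5⟩ | ⟨-, h4, h5, n, hn⟩ | ⟨h4, -⟩)
      · omega
      · exact Or.inr ⟨(mirror_unique hM hn).symm, h4⟩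
      · omega
    · rintro (⟨rfl, rfl⟩ | ⟨rfl, rfl⟩)
      · simp
      · exact Or.inr (Or.inl ⟨by trivial, by trivial, hne, m, hM⟩)
  · by_cases hc' : c = L + 1
    · subst hc'
      have hr : r ≠ 2 ^ k := fun hr => h.2 hr rfl
      rw [pow_succ] at h2
      refine ⟨(r, L), (2 ^ (k + 1) - r, L + 1), ⟨h1, by rw [pow_succ]; exact h2, by simp⟩,
        ⟨by simp only [pow_succ]; omega, by simp only [pow_succ]; omega, by simp⟩, by simp, ?_⟩
      rintro ⟨a, b⟩ ⟨hb1, hb2, hb3⟩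
      simp only [StrandAdj, Prod.mk.injEq, pow_succ] at *
      constructor
      · rintro (⟨h4, h5⟩ | ⟨h4, -⟩ | ⟨-, h4, h5, h6⟩)
        · omega
        · omega
        · omega
      · rintro (⟨rfl, rfl⟩ | ⟨rfl, rfl⟩)
        · simp
        · exact Or.inr (Or.inr ⟨by trivial, by trivial, by omega, by omega⟩)
    · refine ⟨(r, c - 1), (r, c + 1), ⟨h1, h2, by simp only; omega⟩,
        ⟨h1, h2, by simp only; omega⟩, by simp, ?_⟩
      rintro ⟨a, b⟩ -
      simp only [StrandAdj, Prod.mk.injEq]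
      constructor
      · rintro (⟨h4, h5⟩ | ⟨h4, -⟩ | ⟨h4, -⟩) <;> omega
      · rintro (⟨rfl, rfl⟩ | ⟨rfl, rfl⟩) <;> left <;> omega

theorem strandAdj_hub {k L r : ℕ} {q : ℕ × ℕ} (hr : IsHub r) (h : StrandAdj k L (r, 0) q) :
    q = (r, 1) := by
  obtain ⟨a, b⟩ := q
  simp only [StrandAdj, Prod.mk.injEq] at *
  rcases h with ⟨h4, h5⟩ | ⟨-, h4, h5, n, hn⟩ | ⟨h4, -⟩
  · omega
  · exact absurd (hr n a hn) h5
  · omega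

theorem strandAdj_last {k L : ℕ} {q : ℕ × ℕ} (hq : InBox k L q)
    (h : StrandAdj k L (2 ^ k, L + 1) q) : q = (2 ^ k, L) := by
  obtain ⟨a, b⟩ := q
  simp only [StrandAdj, Prod.mk.injEq, InBox, pow_succ] at *
  rcases h with ⟨h4, h5⟩ | ⟨h4, -⟩ | ⟨-, h4, h5, h6⟩ <;> omega

theorem strandAdj_three {k L : ℕ} {p a b c : ℕ × ℕ} (hp : InBox k L p) (ha : InBox k L a)
    (hb : InBox k L b) (hc : InBox k L c) (h1 : StrandAdj k L p a) (h2 : StrandAdj k L p b)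
    (h3 : StrandAdj k L p c) : a = b ∨ a = c ∨ b = c := by
  by_cases h : IsStrandEnd k L p
  · left
    rcases h with ⟨h, h'⟩ | rfl
    · obtain ⟨r, d⟩ := p
      simp only at h h'
      subst h
      rw [strandAdj_hub h' h1, strandAdj_hub h' h2]
    · rw [strandAdj_last ha h1, strandAdj_last hb h2]
  · obtain ⟨x, y, -, -, -, h⟩ := exists_pair_of_not_isStrandEnd hp h
    rw [h _ ha] at h1
    rw [h _ hb] at h2
    rw [h _ hc] at h3
    rcases h1 with rfl | rfl <;> rcases h2 with rfl | rfl <;> rcases h3 with rfl | rfl <;> simp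

/-- The exact power of two dividing a row number is `2 ^ i`. -/
def HasLevel (i r : ℕ) : Prop := 2 ^ i ∣ r ∧ ¬ 2 ^ (i + 1) ∣ r

theorem HasLevel.unique {i j r : ℕ} (h : HasLevel i r) (h' : HasLevel j r) : i = j := by
  rcases lt_trichotomy i j with hlt | heq | hlt
  · exact absurd ((pow_dvd_pow 2 hlt).trans h'.1) h.2
  · exact heq
  · exact absurd ((pow_dvd_pow 2 hlt).trans h.1) h'.2

theorem hasLevel_pow (i : ℕ) : HasLevel i (2 ^ i) :=
  ⟨dvd_rfl, fun h => by
    have := (Nat.pow_dvd_pow_iff_le_right (by norm_num)).1 h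
    omega⟩

theorem hasLevel_three_mul_pow (i : ℕ) : HasLevel i (3 * 2 ^ i) :=
  ⟨dvd_mul_left _ _, fun h => (hasLevel_pow i).2
    ((Nat.Coprime.pow_left (i + 1) (by norm_num : Nat.Coprime 2 3)).dvd_of_dvd_mul_left h)⟩

theorem HasLevel.of_add {i r r' : ℕ} (h : HasLevel i r) (hs : 2 ^ (i + 1) ∣ r + r') :
    HasLevel i r' :=
  ⟨(Nat.dvd_add_right h.1).1 ((pow_dvd_pow 2 (Nat.le_succ i)).trans hs),
    fun h' => h.2 ((Nat.dvd_add_left h').1 hs)⟩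

theorem HasLevel.of_strandAdj {k L i : ℕ} {p q : ℕ × ℕ} (hp : InBox k L p)
    (h : HasLevel i p.1) (hpq : StrandAdj k L p q) : HasLevel i q.1 := by
  rcases hpq with ⟨h1, -⟩ | ⟨-, -, -, m, hm⟩ | ⟨-, -, -, hs⟩
  · rwa [← h1]
  · refine h.of_add ?_
    rw [hm.2.2]
    refine (pow_dvd_pow 2 ?_).mul_left 3
    -- Otherwise `2 ^ (m + 1)` divides a number strictly between itself and its double.
    by_contra hlt
    obtain ⟨x, hx⟩ := (pow_dvd_pow 2 (by omega : m + 1 ≤ i)).trans h.1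
    have h1 := hm.1
    have h2 := hm.lt
    rw [hx, pow_succ _ (m + 1)] at h2
    rw [hx] at h1
    have h3 := lt_of_mul_lt_mul_left h2 (Nat.zero_le _)
    obtain rfl | rfl : x = 0 ∨ x = 1 := by omega
    · simp at h1
    · simp at h1
  · refine h.of_add ?_
    rw [hs]
    refine pow_dvd_pow 2 ?_
    have := (Nat.le_of_dvd hp.1 h.1).trans_lt hp.2.1
    rwa [Nat.pow_lt_pow_iff_right (by norm_num)] at this

theorem inBox_start {k L i : ℕ} (hi : i ≤ k) : InBox k L (2 ^ i, 0) :=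
  ⟨Nat.one_le_two_pow, Nat.pow_lt_pow_right (by norm_num) (by omega), Nat.zero_le _⟩

theorem inBox_target {k L i : ℕ} (hi : i ≤ k) : InBox k L (target k L i) := by
  unfold target
  split_ifs with h
  · exact ⟨Nat.one_le_two_pow, Nat.pow_lt_pow_right (by norm_num) (by omega), le_rfl⟩
  · have h1 : 2 ^ (i + 1) ≤ 2 ^ k := Nat.pow_le_pow_right (by norm_num) (by omega)
    have h2 : 0 < 2 ^ i := by positivity
    rw [pow_succ] at h1
    refine ⟨?_, ?_, Nat.zero_le _⟩
    · simp only; omega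
    · simp only [pow_succ]; omega

theorem finite_inBox (k L : ℕ) : {p | InBox k L p}.Finite :=
  ((Set.finite_Iio (2 ^ (k + 1))).prod (Set.finite_Iic (L + 1))).subset fun _ hp => hp.2

/-- The spanning subgraph of the fold graph that has no vertical edges. -/
def strandGraph (k L : ℕ) : SimpleGraph {p : ℕ × ℕ | InBox k L p} where
  Adj p q := StrandAdj k L p q
  symm := ⟨fun _ _ => StrandAdj.symm⟩
  loopless := ⟨fun p h => (foldGraph k L).loopless.irrefl p.1 ⟨p.2, p.2, Or.inl h⟩⟩

theorem strandGraph_le_foldBox (k L : ℕ) : strandGraph k L ≤ foldBox k L :=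
  fun p q h => ⟨p.2, q.2, Or.inl h⟩

theorem hasLevel_of_reachable {k L i : ℕ} {p q : {p : ℕ × ℕ | InBox k L p}}
    (h : (strandGraph k L).Reachable p q) (hp : HasLevel i p.1.1) : HasLevel i q.1.1 := by
  obtain ⟨w⟩ := h
  induction w with
  | nil => exact hp
  | @cons p _ _ h _ ih => exact ih (hp.of_strandAdj p.2 h)

open Classical in
/-- The strand that begins in a strand end has another end. -/
theorem exists_other_strandEnd {k L : ℕ} (s : {p : ℕ × ℕ | InBox k L p})
    (hs : ∃ a, ∀ q, (strandGraph k L).Adj s q ↔ q = a) :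
    ∃ w, w ≠ s ∧ (strandGraph k L).Reachable s w ∧ IsStrandEnd k L w := by
  have : Fintype {p : ℕ × ℕ | InBox k L p} := (finite_inBox k L).fintype
  -- `K` keeps only the component of `s`, so that the handshake lemma yields a second vertex of odd
  -- degree there.
  let K : SimpleGraph {p : ℕ × ℕ | InBox k L p} :=
    { Adj := fun x y => StrandAdj k L x y ∧ (strandGraph k L).Reachable s x
      symm := ⟨fun x y h => ⟨h.1.symm,
        h.2.trans (Adj.reachable (show (strandGraph k L).Adj x y from h.1))⟩⟩
      loopless := ⟨fun p h => (strandGraph k L).loopless.irrefl p h.1⟩ }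
  obtain ⟨a, ha⟩ := hs
  have hdeg : K.degree s = 1 := by
    rw [← SimpleGraph.card_neighborFinset_eq_degree, Finset.card_eq_one]
    refine ⟨a, ?_⟩
    ext q
    rw [mem_neighborFinset, Finset.mem_singleton]
    exact (and_iff_left (Reachable.refl s)).trans (ha q)
  obtain ⟨w, hw, hodd⟩ := K.exists_ne_odd_degree_of_exists_odd_degree s (by rw [hdeg]; simp)
  refine ⟨w, hw, ?_⟩
  by_cases hr : (strandGraph k L).Reachable s w
  · refine ⟨hr, ?_⟩
    by_contra hend
    obtain ⟨a, b, ha, hb, hab, h⟩ := exists_pair_of_not_isStrandEnd w.2 hend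
    have : K.degree w = 2 := by
      rw [← SimpleGraph.card_neighborFinset_eq_degree, Finset.card_eq_two]
      refine ⟨⟨a, ha⟩, ⟨b, hb⟩, fun h => hab (congrArg Subtype.val h), ?_⟩
      ext q
      rw [mem_neighborFinset, Finset.mem_insert, Finset.mem_singleton, Subtype.ext_iff,
        Subtype.ext_iff]
      exact (and_iff_left hr).trans (h q q.2)
    rw [this] at hodd
    exact absurd hodd (by decide)
  · exfalso
    have : K.degree w = 0 := by
      rw [← SimpleGraph.card_neighborFinset_eq_degree, Finset.card_eq_zero]
      ext q
      rw [mem_neighborFinset]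
      exact iff_of_false (fun h => hr h.2) (Finset.notMem_empty q)
    rw [this] at hodd
    exact absurd hodd (by decide)

/-- The strand has another end, of the same level `i`. Among the strand ends of that level in the
box, only the target differs from the start. -/
theorem reachable_target {k L i : ℕ} (hi : i ≤ k) :
    (strandGraph k L).Reachable ⟨(2 ^ i, 0), inBox_start hi⟩ ⟨target k L i, inBox_target hi⟩ := by
  have h0 := inBox_start (L := L) hi
  have h1 : InBox k L (2 ^ i, 1) := ⟨h0.1, h0.2.1, by simp⟩
  obtain ⟨w, hne, hr, hend⟩ := exists_other_strandEnd (k := k) (L := L)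
    ⟨(2 ^ i, 0), inBox_start hi⟩ ⟨⟨_, h1⟩, fun q =>
      ⟨fun h => Subtype.ext (strandAdj_hub (isHub_pow i) h), by
        rintro rfl
        exact Or.inl ⟨rfl, Or.inl rfl⟩⟩⟩
  have hl := hasLevel_of_reachable hr (hasLevel_pow i)
  suffices h : w.1 = target k L i by rwa [show w = ⟨target k L i, inBox_target hi⟩ from
    Subtype.ext h] at hr
  obtain ⟨⟨r, c⟩, hw⟩ := w
  rcases hend with ⟨rfl, h⟩ | h
  · obtain ⟨j, rfl | rfl⟩ := isHub_iff hw.1 h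
    · obtain rfl := hl.unique (hasLevel_pow j)
      exact absurd rfl hne
    · obtain rfl := hl.unique (hasLevel_three_mul_pow j)
      have h2 := hw.2.1
      have : i ≠ k := by
        rintro rfl
        simp only [pow_succ] at h2
        omega
      simp [target, this]
  · simp only [Prod.mk.injEq] at h
    obtain ⟨rfl, rfl⟩ := h
    obtain rfl := hl.unique (hasLevel_pow k)
    simp [target]

/-! ### Solvability and uniqueness in the finite graph -/

section Box

variable (k L : ℕ)

/-- The first terminals. -/
def boxStart (i : Fin (k + 1)) : {p : ℕ × ℕ | InBox k L p} :=
  ⟨(2 ^ (i : ℕ), 0), inBox_start (Nat.lt_succ_iff.1 i.2)⟩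

/-- The second terminals. -/
def boxTarget (i : Fin (k + 1)) : {p : ℕ × ℕ | InBox k L p} :=
  ⟨target k L i, inBox_target (Nat.lt_succ_iff.1 i.2)⟩

theorem disjointPathsSolvable_foldBox :
    DisjointPathsSolvable (foldBox k L) (boxStart k L) (boxTarget k L) := by
  classical
  have hr : ∀ i, ∃ w : (strandGraph k L).Walk (boxStart k L i) (boxTarget k L i), w.IsPath :=
    fun i => (reachable_target (Nat.lt_succ_iff.1 i.2)).exists_isPath
  choose w hw using hr
  refine ⟨fun i => ⟨(w i).mapLe (strandGraph_le_foldBox k L), (hw i).mapLe _⟩, ?_⟩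
  intro i j hij v hv hv'
  simp only [Walk.support_mapLe_eq_support] at hv hv'
  have h1 := hasLevel_of_reachable (w i |>.takeUntil v hv).reachable (hasLevel_pow i)
  have h2 := hasLevel_of_reachable (w j |>.takeUntil v hv').reachable (hasLevel_pow j)
  exact hij (Fin.ext (h1.unique h2))

variable {k L}

/-- The inclusion of the box. -/
def boxHom (k L : ℕ) : foldBox k L →g foldGraph k L := ⟨Subtype.val, fun h => h⟩

/-- A walk in the box as a walk in the fold graph. -/
def unboxWalk (P : ∀ i, (foldBox k L).Path (boxStart k L i) (boxTarget k L i)) (i : Fin (k + 1)) :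
    (foldGraph k L).Walk (2 ^ (i : ℕ), 0) (target k L i) :=
  (P i).1.map (boxHom k L)

theorem mem_support_unboxWalk (P : ∀ i, (foldBox k L).Path (boxStart k L i) (boxTarget k L i))
    (i : Fin (k + 1)) (x : ℕ × ℕ) :
    x ∈ (unboxWalk P i).support ↔ ∃ y ∈ (P i).1.support, (y : ℕ × ℕ) = x := by
  have h : (unboxWalk P i).support = (P i).1.support.map Subtype.val := Walk.support_map _ _
  rw [h, List.mem_map]

theorem unboxWalk_disjoint {P : ∀ i, (foldBox k L).Path (boxStart k L i) (boxTarget k L i)}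
    (hP : IsDisjointPathsSolution P) (i j : Fin (k + 1)) (hij : i ≠ j) (v : ℕ × ℕ)
    (hv : v ∈ (unboxWalk P i).support) : v ∉ (unboxWalk P j).support := by
  rw [mem_support_unboxWalk] at hv ⊢
  rintro ⟨y', hy', h⟩
  obtain ⟨y, hy, rfl⟩ := hv
  exact hP i j hij y hy (Subtype.ext h ▸ hy')

theorem exists_mem_support_of_solution
    {P : ∀ i, (foldBox k L).Path (boxStart k L i) (boxTarget k L i)}
    (hP : IsDisjointPathsSolution P) (v : {p : ℕ × ℕ | InBox k L p}) :
    ∃ i, v ∈ (P i).1.support := by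
  obtain ⟨i, hi⟩ := mem_support_of_inBox (unboxWalk P) (unboxWalk_disjoint hP) v.2
  obtain ⟨y, hy, h⟩ := (mem_support_unboxWalk P i _).1 hi
  exact ⟨i, Subtype.ext h ▸ hy⟩

theorem strandGraph_adj_of_solution
    {P : ∀ i, (foldBox k L).Path (boxStart k L i) (boxTarget k L i)}
    (hP : IsDisjointPathsSolution P) (i : Fin (k + 1)) (x y : {p : ℕ × ℕ | InBox k L p})
    (h : s(x, y) ∈ (P i).1.edges) : (strandGraph k L).Adj x y := by
  refine strandAdj_of_mem_edges (unboxWalk P) (unboxWalk_disjoint hP) (fun j => ?_) i x y ?_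
  · exact (P j).2.map (f := boxHom k L) Subtype.val_injective
  · have h' : (unboxWalk P i).edges = (P i).1.edges.map (Sym2.map Subtype.val) :=
      Walk.edges_map _ _
    rw [h', List.mem_map]
    exact ⟨_, h, rfl⟩

theorem solution_unique {P Q : ∀ i, (foldBox k L).Path (boxStart k L i) (boxTarget k L i)}
    (hP : IsDisjointPathsSolution P) (hQ : IsDisjointPathsSolution Q) : P = Q := by
  funext i
  refine Subtype.ext (path_unique_of_start_degree_one (H := (strandGraph k L).Adj)
    (fun _ _ h => h.symm) ?_ ?_ _ _ (P i).2 (Q i).2 (strandGraph_adj_of_solution hP i)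
    (strandGraph_adj_of_solution hQ i))
  · intro x a b c h1 h2 h3
    simpa only [Subtype.ext_iff] using strandAdj_three x.2 a.2 b.2 c.2 h1 h2 h3
  · intro a b h1 h2
    exact Subtype.ext ((strandAdj_hub (isHub_pow i) h1).trans (strandAdj_hub (isHub_pow i) h2).symm)

end Box

theorem mainTheorem2 (k : ℕ) (hk : 1 ≤ k) :
    ∃ (V : Type) (_ : Finite V) (G : SimpleGraph V) (s t : Fin (k + 1) → V),
      IsPlanarGraph G ∧
      (gridGraph (2 ^ k + 1) (2 ^ k + 1)).IsContained G ∧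
      (∃! P : ∀ i, G.Path (s i) (t i), IsDisjointPathsSolution P) ∧
      (∀ P : ∀ i, G.Path (s i) (t i), IsDisjointPathsSolution P →
        ∀ v, ∃ i, v ∈ (P i).1.support) ∧
      ∀ v, ¬ IsIrrelevantVertex G s t v := by
  -- The box has `2 ^ (k + 1) - 1` rows, enough for the grid only if `k ≥ 1`.
  have hlt : 2 ^ k + 1 < 2 ^ (k + 1) := by
    have : 2 ^ 1 ≤ 2 ^ k := Nat.pow_le_pow_right (by norm_num) hk
    rw [pow_succ]
    omega
  have hsol := disjointPathsSolvable_foldBox k (2 ^ k + 1)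
  refine ⟨{p : ℕ × ℕ | InBox k (2 ^ k + 1) p}, finite_inBox _ _, foldBox k (2 ^ k + 1),
    boxStart _ _, boxTarget _ _, isPlanarGraph_foldBox _ _, isContained_foldBox hlt le_rfl, ?_,
    fun P hP => exists_mem_support_of_solution hP, fun v =>
      not_isIrrelevantVertex_of_forall_mem hsol fun P hP => exists_mem_support_of_solution hP v⟩
  obtain ⟨P, hP⟩ := hsol
  exact ⟨P, hP, fun Q hQ => solution_unique hQ hP⟩
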